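/- **Setting.** "Smooth" means $C^\infty$. Let $M$ be a smooth $3$-dimensional manifold and let $f,g$ be smooth vector fields on $M$, defining the scalar-input control-affine system $\Sigma=(f,g):\ \dot\xi=f(\xi)+g(\xi)u$, $u\in\mathbb R$. Assume that at every point of $M$ (A1) $f\wedge g\wedge[g,f]\neq 0$, and (A2) $g\wedge[g,f]\wedge[g,[g,f]]\neq0$, where $[\cdot,\cdot]$ is the Lie bracket, $L_{[a,b]}=L_aL_b-L_bL_a$. The structure functions $k_1,k_2,k_3,\lambda_1,\lambda_2,\lambda_3$ of such a pair are defined by $$[f,[f,g]]=k_1g+k_2[g,f]+k_3[g,[g,f]],\qquad [g,[g,f]]=\lambda_1f+\lambda_2g+\lambda_3[g,f].$$ A pair is *canonical* if $k_3\equiv0$ and $\lambda_1=\pm1$ at every point. A canonical pair of $\Sigma$ is a canonical pair of smooth vector fields of the form $f_c=f+\alpha g$, $g_c=\beta g$ with smooth functions $\alpha,\beta$ on $M$, $\beta$ nowhere zero. Its *curvature* $\kappa$ is its structure function $k_1$, and its *centro-affine curvature* $\nu$ is its structure function $\lambda_3$. Two systems $(f,g)$ on $M$ and $(\tilde f,\tilde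 g)$ on $\tilde M$ are locally feedback equivalent at $\xi_0\in M$ and $\tilde \xi_0\in\tilde M$ if there are a smooth diffeomorphism $\phi$ from an open neighbourhood of $\xi_0$ onto an open neighbourhood of $\tilde \xi_0$, with $\phi(\xi_0)=\tilde \xi_0$, and smooth functions $\alpha,\beta$ on the former neighbourhood, $\beta$ nowhere zero, such that there $\tilde f=\phi_*(f+\alpha g)$ and $\tilde g=\phi_*(\beta g)$. The system $\Sigma$ is *locally trivialisable at* $\xi_0$ if it is locally feedback equivalent at $\xi_0$ and some point of $\mathbb R^3$ to a system $$\dot x=F_1(w),\qquad \dot y=F_2(w),\qquad \dot w=u,\qquad (x,y,w)\in\mathbb R^3,$$ with smooth $F_1,F_2:\mathbb R\to\mathbb R$; it is *locally trivialisable* if this holds at every $\xi_0\in M$. **Theorem (Characterisation of trivial systems).** The pair $f_c=f+k_3g$, $g_c=|\lambda_1|^{-1/2}g$ is a canonical pair of $\Sigma$. For every canonical pair $(f_c,g_c)$ of $\Sigma$, with curvature $\kappa$ and centro-affine curvature $\nu$, the system $\Sigma$ is locally trivialisable if and only if $$\kappa=0,\qquad L_{f_c}\nu=0,\qquad L_{[f_c,g_c]}\nu=0\qquad\text{on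 } M;$$ moreover, for each $\xi_0\in M$, $\Sigma$ is locally trivialisable at $\xi_0$ if and only if these three identities hold on some neighbourhood of $\xi_0$. -/

import Mathlib

open scoped Manifold ContDiff Topology

noncomputable section

namespace TrivialControl

/-- The model space `ℝ³`. -/
abbrev E3 : Type := EuclideanSpace ℝ (Fin 3)

/-- Coefficients `c` of `w = c 0 • v 0 + c 1 • v 1 + c 2 • v 2` when `v` is a basis of a
three-dimensional vector space; the value is `0` when `v` is not linearly independent. -/
def frameCoord {V : Type*} [AddCommGroup V] [Module ℝ V] (v : Fin 3 → V) (w : V) :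
    Fin 3 → ℝ :=
  open Classical in
  if h : LinearIndependent ℝ v ∧ Module.finrank ℝ V = 3 then
    ⇑((basisOfLinearIndependentOfCardEqFinrank h.1 (by simp [h.2])).repr w)
  else 0

theorem frameCoord_sum {V : Type*} [AddCommGroup V] [Module ℝ V] (v : Fin 3 → V) (w : V)
    (hv : LinearIndependent ℝ v) (hV : Module.finrank ℝ V = 3) :
    ∑ i, frameCoord v w i • v i = w := by
  classical
  have h : LinearIndependent ℝ v ∧ Module.finrank ℝ V = 3 := ⟨hv, hV⟩
  rw [frameCoord, dif_pos h]
  have := (basisOfLinearIndependentOfCardEqFinrank h.1 (by simp [h.2])).sum_repr w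
  simpa using this

theorem frameCoord_unique {V : Type*} [AddCommGroup V] [Module ℝ V] (v : Fin 3 → V) (w : V)
    (hv : LinearIndependent ℝ v) (hV : Module.finrank ℝ V = 3) (c : Fin 3 → ℝ)
    (hc : ∑ i, c i • v i = w) : c = frameCoord v w := by
  have h1 := frameCoord_sum v w hv hV
  have h2 : ∑ i, (c i - frameCoord v w i) • v i = 0 := by
    simp only [sub_smul, Finset.sum_sub_distrib, hc, h1, sub_self]
  funext i
  exact sub_eq_zero.mp (Fintype.linearIndependent_iff.mp hv _ h2 i)

section Manifold

variable {M : Type*} [TopologicalSpace M] [ChartedSpace E3 M]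
variable {N : Type*} [TopologicalSpace N] [ChartedSpace E3 N]

/-- `f` is a `C^∞` section of the tangent bundle. -/
def IsSmoothVectorField [IsManifold (𝓡 3) ∞ M] (f : ∀ x : M, TangentSpace (𝓡 3) x) :
    Prop :=
  ContMDiff (𝓡 3) (𝓡 3).tangent ∞
    (fun x => (Bundle.TotalSpace.mk' E3 x (f x) : TangentBundle (𝓡 3) M))

/-- The Lie bracket `[f, g]`, i.e. `L_{[f,g]} = L_f L_g - L_g L_f`. -/
abbrev bracket (f g : ∀ x : M, TangentSpace (𝓡 3) x) : ∀ x : M, TangentSpace (𝓡 3) x :=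
  VectorField.mlieBracket (𝓡 3) f g

/-- The Lie derivative `L_f h = ⟨dh, f⟩` of a function. -/
def lieDeriv (f : ∀ x : M, TangentSpace (𝓡 3) x) (h : M → ℝ) (x : M) : ℝ :=
  mfderiv (𝓡 3) 𝓘(ℝ, ℝ) h x (f x)

/-- `f ∧ g ∧ [g,f] ≠ 0` at every point. -/
def AssumptionA1 (f g : ∀ x : M, TangentSpace (𝓡 3) x) : Prop :=
  ∀ x : M, LinearIndependent ℝ ![f x, g x, bracket g f x]

/-- `g ∧ [g,f] ∧ [g,[g,f]] ≠ 0` at every point. -/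
def AssumptionA2 (f g : ∀ x : M, TangentSpace (𝓡 3) x) : Prop :=
  ∀ x : M, LinearIndependent ℝ ![g x, bracket g f x, bracket g (bracket g f) x]

/-- The structure functions `(k₁, k₂, k₃)` (indexed by `0, 1, 2`):
`[f,[f,g]] = k₁ g + k₂ [g,f] + k₃ [g,[g,f]]`. -/
def structK (f g : ∀ x : M, TangentSpace (𝓡 3) x) (i : Fin 3) (x : M) : ℝ :=
  frameCoord ![g x, bracket g f x, bracket g (bracket g f) x] (bracket f (bracket f g) x) i

/-- The structure functions `(λ₁, λ₂, λ₃)` (indexed by `0, 1, 2`):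
`[g,[g,f]] = λ₁ f + λ₂ g + λ₃ [g,f]`. -/
def structL (f g : ∀ x : M, TangentSpace (𝓡 3) x) (i : Fin 3) (x : M) : ℝ :=
  frameCoord ![f x, g x, bracket g f x] (bracket g (bracket g f) x) i

/-- A pair is canonical if `k₃ = 0` and `λ₁ = ±1`. -/
def IsCanonicalPair (f g : ∀ x : M, TangentSpace (𝓡 3) x) : Prop :=
  (∀ x : M, structK f g 2 x = 0) ∧ ∀ x : M, structL f g 0 x = 1 ∨ structL f g 0 x = -1

/-- `(fc, gc)` is a canonical pair of the system `(f, g)`: it is a canonical pair of smooth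
vector fields obtained from `(f, g)` by a smooth feedback transformation
`fc = f + α g`, `gc = β g` with `β` nowhere zero. -/
def IsCanonicalPairOf [IsManifold (𝓡 3) ∞ M] (f g fc gc : ∀ x : M, TangentSpace (𝓡 3) x) : Prop :=
  IsSmoothVectorField fc ∧ IsSmoothVectorField gc ∧
  (∃ α β : M → ℝ, ContMDiff (𝓡 3) 𝓘(ℝ, ℝ) ∞ α ∧ ContMDiff (𝓡 3) 𝓘(ℝ, ℝ) ∞ β ∧
    ∀ x : M, β x ≠ 0 ∧ fc x = f x + α x • g x ∧ gc x = β x • g x) ∧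
  IsCanonicalPair fc gc

/-- The drift `f + k₃ g`. -/
def canonicalDrift (f g : ∀ x : M, TangentSpace (𝓡 3) x) : ∀ x : M, TangentSpace (𝓡 3) x :=
  fun x => f x + structK f g 2 x • g x

/-- The control vector field `|λ₁|^{-1/2} g`. -/
def canonicalControl (f g : ∀ x : M, TangentSpace (𝓡 3) x) :
    ∀ x : M, TangentSpace (𝓡 3) x :=
  fun x => (Real.sqrt |structL f g 0 x|)⁻¹ • g x

/-- The curvature `κ = k₁` of a canonical pair: `[fc,[fc,gc]] = κ gc`. -/
def curvature (fc gc : ∀ x : M, TangentSpace (𝓡 3) x) : M → ℝ := structK fc gc 0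

/-- The centro-affine curvature `ν = λ₃` of a canonical pair:
`[gc,[gc,fc]] = ε fc + μ gc + ν [gc,fc]`. -/
def centroAffineCurvature (fc gc : ∀ x : M, TangentSpace (𝓡 3) x) : M → ℝ :=
  structL fc gc 2

/-- Local feedback equivalence of `(f, g)` at `x₀` and `(f', g')` at `y₀`: there are a smooth
local diffeomorphism `φ` from a neighbourhood of `x₀` with `φ x₀ = y₀` and smooth functions
`α`, `β` there, `β` nowhere zero, with `f' = φ_* (f + α g)` and `g' = φ_* (β g)`. -/
def LocallyFeedbackEquivalentAt (f g : ∀ x : M, TangentSpace (𝓡 3) x) (x₀ : M)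
    (f' g' : ∀ y : N, TangentSpace (𝓡 3) y) (y₀ : N) : Prop :=
  ∃ (φ : PartialDiffeomorph (𝓡 3) (𝓡 3) M N ∞) (α β : M → ℝ),
    x₀ ∈ φ.source ∧ φ x₀ = y₀ ∧
    ContMDiffOn (𝓡 3) 𝓘(ℝ, ℝ) ∞ α φ.source ∧
    ContMDiffOn (𝓡 3) 𝓘(ℝ, ℝ) ∞ β φ.source ∧
    ∀ x ∈ φ.source, β x ≠ 0 ∧
      f' (φ x) = mfderiv (𝓡 3) (𝓡 3) φ x (f x + α x • g x) ∧
      g' (φ x) = mfderiv (𝓡 3) (𝓡 3) φ x (β x • g x)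

/-- The drift `F₁(w) ∂_x + F₂(w) ∂_y` on `ℝ³` with coordinates `(x, y, w) = (z 0, z 1, z 2)`. -/
def trivialDrift (F₁ F₂ : ℝ → ℝ) : ∀ z : E3, TangentSpace (𝓡 3) z :=
  fun z => (!₂[F₁ (z 2), F₂ (z 2), 0] : E3)

/-- The control vector field `∂_w` on `ℝ³`. -/
def trivialControl : ∀ z : E3, TangentSpace (𝓡 3) z :=
  fun _ => (!₂[0, 0, 1] : E3)

/-- `(f, g)` is, locally around `x₀`, feedback equivalent to a trivial system
`x' = F₁(w), y' = F₂(w), w' = u` with smooth `F₁, F₂`. -/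
def LocallyTrivialisableAt (f g : ∀ x : M, TangentSpace (𝓡 3) x) (x₀ : M) : Prop :=
  ∃ (F₁ F₂ : ℝ → ℝ) (z₀ : E3), ContDiff ℝ ∞ F₁ ∧ ContDiff ℝ ∞ F₂ ∧
    LocallyFeedbackEquivalentAt f g x₀ (trivialDrift F₁ F₂) trivialControl z₀

/-- Local trivialisability around every point. -/
def LocallyTrivialisable (f g : ∀ x : M, TangentSpace (𝓡 3) x) : Prop :=
  ∀ x₀ : M, LocallyTrivialisableAt f g x₀

/-- The conditions `κ = 0`, `L_{fc} ν = 0`, `L_{[fc,gc]} ν = 0` at the point `x`. -/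
def TrivialityConditionsAt (fc gc : ∀ x : M, TangentSpace (𝓡 3) x) (x : M) : Prop :=
  curvature fc gc x = 0 ∧
  lieDeriv fc (centroAffineCurvature fc gc) x = 0 ∧
  lieDeriv (bracket fc gc) (centroAffineCurvature fc gc) x = 0

end Manifold

end TrivialControl

end

noncomputable section

namespace TrivialControl

/-! Under a feedback `f' = f + αg`, `g' = βg` one has `λ₁' = β²λ₁` and `k₃' = (k₃ - α)/β`. Taking `α
= k₃` and `β = |λ₁|^{-1/2}` gives a canonical pair, and any other one differs only by the sign of
the control field. All computations take place in `ℝ³`, since brackets, frames and structure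
functions are natural under diffeomorphisms.

Necessity. For a trivial system let `T = F₁∂_x + F₂∂_y`. Both `T` and `[T, G]` lie in the span of
`∂_x, ∂_y` and depend only on `w` when `G` does, hence `[T,[T,G]] = 0`. In particular `k₃ = 0` for
`(T, ∂_w)`, so the canonical drift is `T` itself, and the canonical control is `±|λ₁|^{-1/2}∂_w`,
which depends only on `w` (`canonical_eventuallyEq_dependsOnLast`). Therefore `κ = 0`, and `ν` is a
function of `w`, killed by `T` and `[T, G]`.

Sufficiency. Put `H = [G, F]`. The Jacobi identity with `κ = k₃ = 0` forces `k₂ = 0`, and with `L_F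
ν = 0` also `λ₂ = 0` (`canonical_jacobi`). So `[F,H] = 0` and `[G,H] = εF + νH`. No bracket has a
`G` component, so the form dual to `G` is closed, say `ds`; since `ν` is killed by `F` and `H`,
locally `ν = N(s)`. The form with values `p(s), 0, p'(s)` on `F, G, H` is closed exactly when `p'' =
εp + Np'`. Two independent solutions `p₁, p₂` yield primitives `P, Q`, and in the coordinates `(P,
Q, s)` one reads `F = p₁(s)∂_P + p₂(s)∂_Q`, `G = ∂_s`. -/

/-! ### Naturality of frame coordinates -/

theorem frameCoord_map {V W : Type*} [AddCommGroup V] [Module ℝ V] [AddCommGroup W] [Module ℝ W]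
    (e : V ≃ₗ[ℝ] W) (v : Fin 3 → V) (w : V) :
    frameCoord (fun i => e (v i)) (e w) = frameCoord v w := by
  by_cases h : LinearIndependent ℝ v ∧ Module.finrank ℝ V = 3
  · have h1 : LinearIndependent ℝ (fun i => e (v i)) :=
      h.1.map' e.toLinearMap (LinearMap.ker_eq_bot.2 e.injective)
    refine (frameCoord_unique _ _ h1 (e.finrank_eq ▸ h.2) _ ?_).symm
    rw [← congrArg e (frameCoord_sum v w h.1 h.2)]
    simp [Fin.sum_univ_three]
  · have h' : ¬ (LinearIndependent ℝ (fun i => e (v i)) ∧ Module.finrank ℝ W = 3) := by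
      rintro ⟨h1, h2⟩
      refine h ⟨?_, e.finrank_eq.trans h2⟩
      exact LinearIndependent.of_comp e.toLinearMap h1
    rw [frameCoord, frameCoord, dif_neg h, dif_neg h']

theorem frameCoord_map_three {V W : Type*} [AddCommGroup V] [Module ℝ V] [AddCommGroup W]
    [Module ℝ W] (e : V ≃ₗ[ℝ] W) (a b c w : V) :
    frameCoord ![e a, e b, e c] (e w) = frameCoord ![a, b, c] w := by
  rw [← frameCoord_map e]
  congr 1
  funext i
  fin_cases i <;> rfl

theorem linearIndependent_map_three {V W : Type*} [AddCommGroup V] [Module ℝ V] [AddCommGroup W]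
    [Module ℝ W] (e : V ≃ₗ[ℝ] W) (a b c : V) :
    LinearIndependent ℝ ![e a, e b, e c] ↔ LinearIndependent ℝ ![a, b, c] := by
  have : ![e a, e b, e c] = e.toLinearMap ∘ ![a, b, c] := by
    funext i
    fin_cases i <;> rfl
  rw [this]
  exact e.toLinearMap.linearIndependent_iff (LinearMap.ker_eq_bot.2 e.injective)

/-! ### Structure functions on `ℝ³` and transport by diffeomorphisms -/

open VectorField

/-- The structure functions `k` for vector fields on an Euclidean space. -/
def eK (F G : E3 → E3) (i : Fin 3) (z : E3) : ℝ :=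
  frameCoord ![G z, lieBracket ℝ G F z, lieBracket ℝ G (lieBracket ℝ G F) z]
    (lieBracket ℝ F (lieBracket ℝ F G) z) i

/-- The structure functions `λ` for vector fields on an Euclidean space. -/
def eL (F G : E3 → E3) (i : Fin 3) (z : E3) : ℝ :=
  frameCoord ![F z, G z, lieBracket ℝ G F z] (lieBracket ℝ G (lieBracket ℝ G F) z) i

/-- `F ∧ G ∧ [G,F] ≠ 0` at `z`. -/
def A1At (F G : E3 → E3) (z : E3) : Prop := LinearIndependent ℝ ![F z, G z, lieBracket ℝ G F z]

/-- `G ∧ [G,F] ∧ [G,[G,F]] ≠ 0` at `z`. -/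
def A2At (F G : E3 → E3) (z : E3) : Prop :=
  LinearIndependent ℝ ![G z, lieBracket ℝ G F z, lieBracket ℝ G (lieBracket ℝ G F) z]

section Transport

variable {M : Type*} [TopologicalSpace M] [ChartedSpace E3 M]

/-- Push-forward of a vector field under a partial diffeomorphism to `ℝ³`. -/
def push (φ : PartialDiffeomorph (𝓡 3) (𝓡 3) M E3 ∞) (f : ∀ x : M, TangentSpace (𝓡 3) x) :
    E3 → E3 :=
  mpullback (𝓡 3) (𝓡 3) φ.symm f

variable (φ : PartialDiffeomorph (𝓡 3) (𝓡 3) M E3 ∞)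

theorem symm_apply_self {x : M} (hx : x ∈ φ.source) : φ.symm (φ x) = x := φ.left_inv hx

theorem apply_symm_self {z : E3} (hz : z ∈ φ.target) : φ (φ.symm z) = z := φ.right_inv hz

theorem symm_mem {z : E3} (hz : z ∈ φ.target) : φ.symm z ∈ φ.source := φ.map_target hz

theorem apply_mem {x : M} (hx : x ∈ φ.source) : φ x ∈ φ.target := φ.map_source hx

theorem symm_contMDiffAt {z : E3} (hz : z ∈ φ.target) :
    ContMDiffAt (𝓡 3) (𝓡 3) ∞ φ.symm z :=
  (φ.symm.isLocalDiffeomorphAt _ _ _ hz).contMDiffAt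

theorem mfderiv_symm_apply {x : M} (hx : x ∈ φ.source) (v : TangentSpace (𝓡 3) x) :
    mfderiv (𝓡 3) (𝓡 3) φ.symm (φ x) (mfderiv (𝓡 3) (𝓡 3) φ x v) = v := by
  have h1 : MDifferentiableAt (𝓡 3) (𝓡 3) φ x := φ.mdifferentiableAt (by simp) hx
  have h2 : MDifferentiableAt (𝓡 3) (𝓡 3) φ.symm (φ x) :=
    φ.symm.mdifferentiableAt (by simp) (apply_mem φ hx)
  have h3 := mfderiv_comp x h2 h1
  have h4 : (φ.symm ∘ φ : M → M) =ᶠ[𝓝 x] id := by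
    filter_upwards [φ.open_source.mem_nhds hx] with y hy using symm_apply_self φ hy
  rw [h4.mfderiv_eq, mfderiv_id] at h3
  exact (congrArg (fun L => L v) h3).symm

theorem isInvertible_mfderiv_symm {z : E3} (hz : z ∈ φ.target) :
    (mfderiv (𝓡 3) (𝓡 3) φ.symm z).IsInvertible :=
  ⟨(φ.symm.isLocalDiffeomorphAt _ _ _ hz).mfderivToContinuousLinearEquiv (by simp), rfl⟩

/-- The differential of the inverse of a partial diffeomorphism as a linear equivalence. -/
def dSymmEquiv {z : E3} (hz : z ∈ φ.target) : E3 ≃L[ℝ] TangentSpace (𝓡 3) (φ.symm z) :=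
  (φ.symm.isLocalDiffeomorphAt _ _ _ hz).mfderivToContinuousLinearEquiv (by simp)

/-- At each point of the target the push-forward is a linear equivalence, so independence and frame
coordinates can be carried through it by linear algebra alone. -/
theorem push_eq_symm (f : ∀ x : M, TangentSpace (𝓡 3) x) {z : E3} (hz : z ∈ φ.target) :
    push φ f z = (dSymmEquiv φ hz).symm (f (φ.symm z)) := by
  change (mfderiv (𝓡 3) (𝓡 3) φ.symm z).inverse (f (φ.symm z)) = _
  exact congrArg (fun L => L (f (φ.symm z)))
    (ContinuousLinearMap.inverse_equiv (dSymmEquiv φ hz))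

theorem push_apply (f : ∀ x : M, TangentSpace (𝓡 3) x) {x : M} (hx : x ∈ φ.source) :
    push φ f (φ x) = mfderiv (𝓡 3) (𝓡 3) φ x (f x) := by
  obtain ⟨z, hz, rfl⟩ : ∃ z ∈ φ.target, φ.symm z = x :=
    ⟨φ x, apply_mem φ hx, symm_apply_self φ hx⟩
  have h1 := mfderiv_symm_apply φ hx (f (φ.symm z))
  rw [apply_symm_self φ hz] at h1 ⊢
  rw [push_eq_symm φ f hz]
  exact (dSymmEquiv φ hz).symm_apply_eq.2 h1.symm

theorem lieDeriv_push (f : ∀ x : M, TangentSpace (𝓡 3) x) {h : M → ℝ} {k : E3 → ℝ} {z : E3}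
    (hz : z ∈ φ.target) (hk : DifferentiableAt ℝ k z)
    (hhk : ∀ y ∈ φ.target, h (φ.symm y) = k y) :
    lieDeriv f h (φ.symm z) = fderiv ℝ k z (push φ f z) := by
  have h1 : h =ᶠ[𝓝 (φ.symm z)] k ∘ φ := by
    filter_upwards [φ.open_source.mem_nhds (symm_mem φ hz)] with y hy
    rw [Function.comp_apply, ← hhk _ (apply_mem φ hy), symm_apply_self φ hy]
  have h2 : MDifferentiableAt (𝓡 3) 𝓘(ℝ, ℝ) k (φ (φ.symm z)) := by
    rw [apply_symm_self φ hz]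
    exact hk.mdifferentiableAt
  rw [lieDeriv, h1.mfderiv_eq, mfderiv_comp _ h2 (φ.mdifferentiableAt (by simp) (symm_mem φ hz))]
  have h3 := push_apply φ f (symm_mem φ hz)
  rw [apply_symm_self φ hz] at h3
  rw [h3]
  change mfderiv _ _ k (φ (φ.symm z)) _ = _
  rw [apply_symm_self φ hz, mfderiv_eq_fderiv]
  rfl

variable [IsManifold (𝓡 3) ∞ M]

theorem push_contDiffAt {f : ∀ x : M, TangentSpace (𝓡 3) x} (hf : IsSmoothVectorField f)
    {z : E3} (hz : z ∈ φ.target) : ContDiffAt ℝ ∞ (push φ f) z := by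
  have : IsManifold (𝓡 3) 1 M := IsManifold.of_le (n := ∞) (by simp)
  have := ContMDiffAt.mpullback_vectorField_preimage (n := ∞) (m := ∞) (hf (φ.symm z))
    (symm_contMDiffAt φ hz) (isInvertible_mfderiv_symm φ hz) (by simp)
  exact contMDiffAt_vectorSpace_iff_contDiffAt.1 this

theorem bracket_smooth {f g : ∀ x : M, TangentSpace (𝓡 3) x} (hf : IsSmoothVectorField f)
    (hg : IsSmoothVectorField g) : IsSmoothVectorField (bracket f g) := by
  have : IsManifold (𝓡 3) (((⊤ : ℕ∞) : ℕ∞ω) + 1) M := by simpa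
  have : IsManifold (𝓡 3) (minSmoothness ℝ 2) M :=
    IsManifold.of_le (n := ∞) (by simpa using ENat.LEInfty.out)
  have : IsManifold (𝓡 3) (minSmoothness ℝ 3) M :=
    IsManifold.of_le (n := ∞) (by simpa using ENat.LEInfty.out)
  exact ContDiff.mlieBracket_vectorField (n := ⊤) (m := ⊤) hf hg (by simp)

theorem push_bracket {f g : ∀ x : M, TangentSpace (𝓡 3) x} (hf : IsSmoothVectorField f)
    (hg : IsSmoothVectorField g) {z : E3} (hz : z ∈ φ.target) :
    push φ (bracket f g) z = lieBracket ℝ (push φ f) (push φ g) z := by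
  have : IsManifold (𝓡 3) (minSmoothness ℝ 3) M := 
    IsManifold.of_le (n := ∞) (by simpa using ENat.LEInfty.out)
  rw [push, mpullback_mlieBracket (n := ∞) ((hf _).mdifferentiableAt (by simp))
    ((hg _).mdifferentiableAt (by simp)) (symm_contMDiffAt φ hz)
    (by simpa using ENat.LEInfty.out), ← mlieBracketWithin_univ, ← lieBracketWithin_univ]
  exact congrFun mlieBracketWithin_eq_lieBracketWithin z

theorem push_bracket_eventually {f g : ∀ x : M, TangentSpace (𝓡 3) x}
    (hf : IsSmoothVectorField f) (hg : IsSmoothVectorField g) {z : E3} (hz : z ∈ φ.target) :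
    push φ (bracket f g) =ᶠ[𝓝 z] lieBracket ℝ (push φ f) (push φ g) := by
  filter_upwards [φ.open_target.mem_nhds hz] with y hy using push_bracket φ hf hg hy

theorem push_bracket_bracket {f g h : ∀ x : M, TangentSpace (𝓡 3) x} (hf : IsSmoothVectorField f)
    (hg : IsSmoothVectorField g) (hh : IsSmoothVectorField h) {z : E3} (hz : z ∈ φ.target) :
    push φ (bracket h (bracket f g)) z =
      lieBracket ℝ (push φ h) (lieBracket ℝ (push φ f) (push φ g)) z := by
  rw [push_bracket φ hh (bracket_smooth hf hg) hz]
  exact Filter.EventuallyEq.lieBracket_vectorField_eq Filter.EventuallyEq.rfl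
    (push_bracket_eventually φ hf hg hz)

theorem eK_push {f g : ∀ x : M, TangentSpace (𝓡 3) x} (hf : IsSmoothVectorField f)
    (hg : IsSmoothVectorField g) (i : Fin 3) {z : E3} (hz : z ∈ φ.target) :
    eK (push φ f) (push φ g) i z = structK f g i (φ.symm z) := by
  rw [eK, ← push_bracket_bracket φ hg hf hg hz, ← push_bracket_bracket φ hf hg hf hz,
    ← push_bracket φ hg hf hz, push_eq_symm φ _ hz, push_eq_symm φ _ hz, push_eq_symm φ _ hz,
    push_eq_symm φ _ hz]
  exact congrFun (frameCoord_map_three (dSymmEquiv φ hz).symm.toLinearEquiv _ _ _ _) i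

theorem eL_push {f g : ∀ x : M, TangentSpace (𝓡 3) x} (hf : IsSmoothVectorField f)
    (hg : IsSmoothVectorField g) (i : Fin 3) {z : E3} (hz : z ∈ φ.target) :
    eL (push φ f) (push φ g) i z = structL f g i (φ.symm z) := by
  rw [eL, ← push_bracket_bracket φ hg hf hg hz, 
    ← push_bracket φ hg hf hz, push_eq_symm φ _ hz, push_eq_symm φ _ hz, push_eq_symm φ _ hz,
    push_eq_symm φ _ hz]
  exact congrFun (frameCoord_map_three (dSymmEquiv φ hz).symm.toLinearEquiv _ _ _ _) i

theorem a1At_push {f g : ∀ x : M, TangentSpace (𝓡 3) x} (hf : IsSmoothVectorField f)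
    (hg : IsSmoothVectorField g) (hA : AssumptionA1 f g) {z : E3} (hz : z ∈ φ.target) :
    A1At (push φ f) (push φ g) z := by
  rw [A1At, ← push_bracket φ hg hf hz, push_eq_symm φ _ hz, push_eq_symm φ _ hz,
    push_eq_symm φ _ hz]
  exact (linearIndependent_map_three (dSymmEquiv φ hz).symm.toLinearEquiv _ _ _).2 (hA _)

theorem a2At_push {f g : ∀ x : M, TangentSpace (𝓡 3) x} (hf : IsSmoothVectorField f)
    (hg : IsSmoothVectorField g) (hA : AssumptionA2 f g) {z : E3} (hz : z ∈ φ.target) :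
    A2At (push φ f) (push φ g) z := by
  rw [A2At, ← push_bracket_bracket φ hg hf hg hz, ← push_bracket φ hg hf hz,
    push_eq_symm φ _ hz, push_eq_symm φ _ hz, push_eq_symm φ _ hz]
  exact (linearIndependent_map_three (dSymmEquiv φ hz).symm.toLinearEquiv _ _ _).2 (hA _)

end Transport

/-! ### Linear algebra of three-vector frames -/

section LinearAlgebra

variable {V : Type*} [AddCommGroup V] [Module ℝ V]

theorem linearIndependent_three_iff (x y z : V) :
    LinearIndependent ℝ ![x, y, z] ↔
      ∀ a b c : ℝ, a • x + b • y + c • z = 0 → a = 0 ∧ b = 0 ∧ c = 0 := by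
  rw [Fintype.linearIndependent_iff]
  constructor
  · intro h a b c habc
    have := h ![a, b, c] (by simpa [Fin.sum_univ_three] using habc)
    exact ⟨this 0, this 1, this 2⟩
  · intro h c hc i
    obtain ⟨h0, h1, h2⟩ := h (c 0) (c 1) (c 2) (by simpa [Fin.sum_univ_three] using hc)
    fin_cases i <;> assumption

theorem frameCoord_three {x y z w : V} (h : LinearIndependent ℝ ![x, y, z])
    (hV : Module.finrank ℝ V = 3) {a b c : ℝ} (hw : w = a • x + b • y + c • z) :
    frameCoord ![x, y, z] w = ![a, b, c] :=
  (frameCoord_unique _ _ h hV _ (by simp [Fin.sum_univ_three, hw])).symm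

theorem frameCoord_three_sum {x y z : V} (h : LinearIndependent ℝ ![x, y, z])
    (hV : Module.finrank ℝ V = 3) (w : V) :
    w = frameCoord ![x, y, z] w 0 • x + frameCoord ![x, y, z] w 1 • y +
      frameCoord ![x, y, z] w 2 • z := by
  have := frameCoord_sum _ w h hV
  rw [Fin.sum_univ_three] at this
  exact this.symm

/-- `frameCoord` takes the default value `0` on a dependent family, so a nonzero value certifies a
frame. -/
theorem linearIndependent_of_frameCoord_ne_zero {v : Fin 3 → V} {w : V} {i : Fin 3}
    (h : frameCoord v w i ≠ 0) : LinearIndependent ℝ v := by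
  by_contra hv
  exact h (by rw [frameCoord, dif_neg (fun hh => hv hh.1)]; rfl)

theorem linearIndependent_drift {x y w : V} (h : LinearIndependent ℝ ![x, y, w]) {b : ℝ}
    (hb : b ≠ 0) (a m : ℝ) : LinearIndependent ℝ ![x + a • y, b • y, b • w + m • y] := by
  rw [linearIndependent_three_iff] at h ⊢
  intro c d e hc
  obtain ⟨h0, h1, h2⟩ := h c (c * a + d * b + e * m) (e * b) (by rw [← hc]; module)
  have h3 : e = 0 := by simpa [hb] using h2
  subst h0 h3
  exact ⟨rfl, by simpa [hb] using h1, rfl⟩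

theorem linearIndependent_control {x y w : V} (h : LinearIndependent ℝ ![x, y, w]) {b : ℝ}
    (hb : b ≠ 0) (m p q : ℝ) :
    LinearIndependent ℝ ![b • x, b • y + m • x, b ^ 2 • w + p • y + q • x] := by
  rw [linearIndependent_three_iff] at h ⊢
  intro c d e hc
  obtain ⟨h0, h1, h2⟩ := h (c * b + d * m + e * q) (d * b + e * p) (e * b ^ 2)
    (by rw [← hc]; module)
  have h3 : e = 0 := by simpa [hb] using h2
  subst h3
  have h4 : d = 0 := by simpa [hb] using h1
  subst h4
  exact ⟨by simpa [hb] using h0, rfl, rfl⟩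

/-- With `k = [G,[G,F]]` and `a = λ₁`, this derives (A2) from (A1) and `λ₁ ≠ 0`; `coeff_ne_zero`
supplies the converse direction. -/
theorem linearIndependent_replace {x y w k : V} (h : LinearIndependent ℝ ![x, y, w]) {a b c : ℝ}
    (ha : a ≠ 0) (hk : k = a • x + b • y + c • w) : LinearIndependent ℝ ![y, w, k] := by
  rw [linearIndependent_three_iff] at h ⊢
  intro d e t ht
  obtain ⟨h0, h1, h2⟩ := h (t * a) (d + t * b) (e + t * c) (by rw [← ht, hk]; module)
  have h3 : t = 0 := by simpa [ha] using h0
  subst h3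
  exact ⟨by simpa using h1, by simpa using h2, rfl⟩

theorem coeff_ne_zero {x y w k : V} (h : LinearIndependent ℝ ![y, w, k]) {a b c : ℝ}
    (hk : k = a • x + b • y + c • w) : a ≠ 0 := by
  rintro rfl
  rw [linearIndependent_three_iff] at h
  simpa using (h (-b) (-c) 1 (by rw [hk]; module)).2.2

end LinearAlgebra

/-! ### Smoothness of frame coordinates and structure functions -/

theorem finrank_E3 : Module.finrank ℝ E3 = 3 := by simp

/-- The linear map `c ↦ ∑ i, c i • v i`. -/
def frameMap (v : Fin 3 → E3) : E3 →L[ℝ] E3 :=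
  ∑ i, (EuclideanSpace.proj i : E3 →L[ℝ] ℝ).smulRight (v i)

theorem frameMap_apply (v : Fin 3 → E3) (c : E3) : frameMap v c = ∑ i, c i • v i := by
  simp [frameMap]

theorem frameMap_isInvertible {v : Fin 3 → E3} (hv : LinearIndependent ℝ v) :
    (frameMap v).IsInvertible := by
  have hinj : Function.Injective (frameMap v).toLinearMap := by
    rw [← LinearMap.ker_eq_bot, LinearMap.ker_eq_bot']
    intro c hc
    ext i
    exact Fintype.linearIndependent_iff.1 hv c ((frameMap_apply v c).symm.trans hc) i
  refine ⟨(LinearEquiv.ofInjectiveEndo _ hinj).toContinuousLinearEquiv, ?_⟩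
  ext1 c
  rfl

/-- Writing coordinates through the inverse of a linear map makes them smooth in the frame, because
inversion of continuous linear maps is smooth at invertible ones. -/
theorem frameCoord_eq_inverse {v : Fin 3 → E3} (hv : LinearIndependent ℝ v) (w : E3) (i : Fin 3) :
    frameCoord v w i = (frameMap v).inverse w i := by
  obtain ⟨e, he⟩ := frameMap_isInvertible hv
  rw [← he, ContinuousLinearMap.inverse_equiv]
  refine (congrFun (frameCoord_unique v w hv finrank_E3 _ ?_) i).symm
  rw [← frameMap_apply, ← he]
  exact e.apply_symm_apply w

theorem eventually_linearIndependent {a b c : E3 → E3} {z : E3} (ha : ContinuousAt a z)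
    (hb : ContinuousAt b z) (hc : ContinuousAt c z)
    (h : LinearIndependent ℝ ![a z, b z, c z]) :
    ∀ᶠ y in 𝓝 z, LinearIndependent ℝ ![a y, b y, c y] := by
  have h1 : ContinuousAt (fun y => ![a y, b y, c y]) z := by
    rw [continuousAt_pi]
    intro i
    fin_cases i <;> assumption
  exact h1.eventually (isOpen_setOfPred_linearIndependent.mem_nhds h)

theorem contDiffAt_frameMap {a b c : E3 → E3} {z : E3} (ha : ContDiffAt ℝ ∞ a z)
    (hb : ContDiffAt ℝ ∞ b z) (hc : ContDiffAt ℝ ∞ c z) :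
    ContDiffAt ℝ ∞ (fun y => frameMap ![a y, b y, c y]) z := by
  refine ContDiffAt.sum fun i _ => ?_
  refine contDiffAt_const.smulRight ?_
  fin_cases i <;> assumption

theorem contDiffAt_inverse_frameMap {a b c : E3 → E3} {z : E3} (ha : ContDiffAt ℝ ∞ a z)
    (hb : ContDiffAt ℝ ∞ b z) (hc : ContDiffAt ℝ ∞ c z)
    (h : LinearIndependent ℝ ![a z, b z, c z]) :
    ContDiffAt ℝ ∞ (fun y => (frameMap ![a y, b y, c y]).inverse) z :=
  ContDiffAt.comp (g := ContinuousLinearMap.inverse) z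
    (frameMap_isInvertible h).contDiffAt_map_inverse (contDiffAt_frameMap ha hb hc)

theorem contDiffAt_frameCoord {a b c w : E3 → E3} {z : E3} (ha : ContDiffAt ℝ ∞ a z)
    (hb : ContDiffAt ℝ ∞ b z) (hc : ContDiffAt ℝ ∞ c z) (hw : ContDiffAt ℝ ∞ w z)
    (h : LinearIndependent ℝ ![a z, b z, c z]) (i : Fin 3) :
    ContDiffAt ℝ ∞ (fun y => frameCoord ![a y, b y, c y] (w y) i) z := by
  have h1 := (contDiffAt_inverse_frameMap ha hb hc h).clm_apply hw
  have h2 : ContDiffAt ℝ ∞ (fun y => (frameMap ![a y, b y, c y]).inverse (w y) i) z :=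
    (EuclideanSpace.proj i : E3 →L[ℝ] ℝ).contDiff.contDiffAt.comp z h1
  refine h2.congr_of_eventuallyEq ?_
  filter_upwards [eventually_linearIndependent ha.continuousAt hb.continuousAt hc.continuousAt h]
    with y hy using frameCoord_eq_inverse hy _ i

theorem contDiffAt_lieBracket {F G : E3 → E3} {z : E3} (hF : ContDiffAt ℝ ∞ F z)
    (hG : ContDiffAt ℝ ∞ G z) : ContDiffAt ℝ ∞ (lieBracket ℝ F G) z :=
  hF.lieBracket_vectorField hG (by simp)

theorem contDiffAt_eK {F G : E3 → E3} {z : E3} (hF : ContDiffAt ℝ ∞ F z)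
    (hG : ContDiffAt ℝ ∞ G z) (h : A2At F G z) (i : Fin 3) : ContDiffAt ℝ ∞ (eK F G i) z :=
  contDiffAt_frameCoord hG (contDiffAt_lieBracket hG hF)
    (contDiffAt_lieBracket hG (contDiffAt_lieBracket hG hF))
    (contDiffAt_lieBracket hF (contDiffAt_lieBracket hF hG)) h i

theorem contDiffAt_eL {F G : E3 → E3} {z : E3} (hF : ContDiffAt ℝ ∞ F z)
    (hG : ContDiffAt ℝ ∞ G z) (h : A1At F G z) (i : Fin 3) : ContDiffAt ℝ ∞ (eL F G i) z :=
  contDiffAt_frameCoord hF hG (contDiffAt_lieBracket hG hF)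
    (contDiffAt_lieBracket hG (contDiffAt_lieBracket hG hF)) h i

theorem eK_sum {F G : E3 → E3} {z : E3} (h : A2At F G z) :
    lieBracket ℝ F (lieBracket ℝ F G) z = eK F G 0 z • G z + eK F G 1 z • lieBracket ℝ G F z +
      eK F G 2 z • lieBracket ℝ G (lieBracket ℝ G F) z :=
  frameCoord_three_sum h finrank_E3 _

theorem eL_sum {F G : E3 → E3} {z : E3} (h : A1At F G z) :
    lieBracket ℝ G (lieBracket ℝ G F) z = eL F G 0 z • F z + eL F G 1 z • G z +
      eL F G 2 z • lieBracket ℝ G F z :=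
  frameCoord_three_sum h finrank_E3 _

theorem eL_zero_ne_zero {F G : E3 → E3} {z : E3} (h1 : A1At F G z) (h2 : A2At F G z) :
    eL F G 0 z ≠ 0 :=
  coeff_ne_zero h2 (eL_sum h1)

/-- Because of the default value `0`, the condition `λ₁ = ±1` of a canonical pair already contains
(A1), and then also (A2). -/
theorem a1At_of_eL_ne_zero {F G : E3 → E3} {z : E3} (h : eL F G 0 z ≠ 0) : A1At F G z :=
  linearIndependent_of_frameCoord_ne_zero h

theorem a2At_of_eL_ne_zero {F G : E3 → E3} {z : E3} (h : eL F G 0 z ≠ 0) : A2At F G z :=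
  linearIndependent_replace (a1At_of_eL_ne_zero h) h (eL_sum (a1At_of_eL_ne_zero h))

/-! ### Brackets and structure functions under feedback -/

section Brackets

variable {F G F' G' : E3 → E3} {a b m : E3 → ℝ} {z : E3}

theorem lieBracket_smul_add_smul_right (V : E3 → E3) (ha : DifferentiableAt ℝ a z)
    (hb : DifferentiableAt ℝ b z) (hF : DifferentiableAt ℝ F z) (hG : DifferentiableAt ℝ G z) :
    lieBracket ℝ V (fun y => a y • F y + b y • G y) z =
      (fderiv ℝ a z (V z) • F z + a z • lieBracket ℝ V F z) +
      (fderiv ℝ b z (V z) • G z + b z • lieBracket ℝ V G z) := by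
  have : (fun y => a y • F y + b y • G y) = (fun y => a y • F y) + (fun y => b y • G y) := rfl
  rw [this, lieBracket_add_right (ha.fun_smul hF) (hb.fun_smul hG), lieBracket_smul_right ha hF,
    lieBracket_smul_right hb hG]

theorem lieBracket_add_smul_left (V : E3 → E3) (ha : DifferentiableAt ℝ a z)
    (hF : DifferentiableAt ℝ F z) (hG : DifferentiableAt ℝ G z) :
    lieBracket ℝ (fun y => F y + a y • G y) V z =
      lieBracket ℝ F V z + (-fderiv ℝ a z (V z) • G z + a z • lieBracket ℝ G V z) := by
  have : (fun y => F y + a y • G y) = F + (fun y => a y • G y) := rfl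
  rw [this, lieBracket_add_left hF (ha.fun_smul hG), lieBracket_smul_left ha hG]

/-- The function `m` with `[bG, F + aG] = b[G,F] + mG`. -/
def bracketShift (F G : E3 → E3) (a b : E3 → ℝ) (y : E3) : ℝ :=
  b y * fderiv ℝ a y (G y) - fderiv ℝ b y (F y + a y • G y)

theorem contDiffAt_bracketShift (hF : ContDiffAt ℝ ∞ F z) (hG : ContDiffAt ℝ ∞ G z)
    (ha : ContDiffAt ℝ ∞ a z) (hb : ContDiffAt ℝ ∞ b z) :
    ContDiffAt ℝ ∞ (bracketShift F G a b) z := by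
  have h1 := ha.fderiv_right (m := ∞) (by simp)
  have h2 := hb.fderiv_right (m := ∞) (by simp)
  exact (hb.mul (h1.clm_apply hG)).sub (h2.clm_apply (hF.add (ha.smul hG)))

theorem diffAt {E : Type*} [NormedAddCommGroup E] [NormedSpace ℝ E]
    {u : E3 → E} (hu : ContDiffAt ℝ ∞ u z) : DifferentiableAt ℝ u z :=
  hu.differentiableAt (by simp)

theorem eventually_differentiableAt {E : Type*} [NormedAddCommGroup E] [NormedSpace ℝ E]
    {u : E3 → E} (hu : ContDiffAt ℝ ∞ u z) : ∀ᶠ y in 𝓝 z, DifferentiableAt ℝ u y := by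
  filter_upwards [(hu.of_le (m := 1) (by simp)).eventually (by simp)] with y hy
  exact hy.differentiableAt (by simp)

theorem feedback_bracket (hF : DifferentiableAt ℝ F z) (hG : DifferentiableAt ℝ G z)
    (ha : DifferentiableAt ℝ a z) (hb : DifferentiableAt ℝ b z) :
    lieBracket ℝ (fun y => b y • G y) (fun y => F y + a y • G y) z =
      b z • lieBracket ℝ G F z + bracketShift F G a b z • G z := by
  rw [lieBracket_smul_left hb hG, lieBracket_swap, lieBracket_add_smul_left G ha hF hG,
    lieBracket_swap (V := F), bracketShift]
  simp only [lieBracket_self, Pi.zero_apply]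
  module

/-- Applied with `[G,F]` in the place of `F`. Only the coefficient of the highest bracket enters the
laws for `λ₁` and `k₃`, so the lower-order terms stay existential. -/
theorem feedback_control_bracket (hG : DifferentiableAt ℝ G z) (hH : DifferentiableAt ℝ F z)
    (hb : DifferentiableAt ℝ b z) (hm : DifferentiableAt ℝ m z) :
    ∃ p q : ℝ, lieBracket ℝ (fun y => b y • G y) (fun y => b y • F y + m y • G y) z =
      b z ^ 2 • lieBracket ℝ G F z + p • F z + q • G z := by
  rw [lieBracket_smul_left hb hG, lieBracket_smul_add_smul_right G hb hm hH hG]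
  simp only [lieBracket_self, Pi.zero_apply]
  refine ⟨b z * fderiv ℝ b z (G z), b z * fderiv ℝ m z (G z) -
    fderiv ℝ b z (b z • F z + m z • G z), ?_⟩
  module

theorem feedback_drift_bracket {H : E3 → E3} (hF : DifferentiableAt ℝ F z)
    (hG : DifferentiableAt ℝ G z) (hH : DifferentiableAt ℝ H z) (ha : DifferentiableAt ℝ a z)
    (hb : DifferentiableAt ℝ b z) (hm : DifferentiableAt ℝ m z) :
    ∃ p q : ℝ, lieBracket ℝ (fun y => F y + a y • G y) (fun y => b y • H y + m y • G y) z =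
      b z • lieBracket ℝ F H z + (b z * a z) • lieBracket ℝ G H z +
        (m z) • lieBracket ℝ F G z + p • H z + q • G z := by
  rw [lieBracket_smul_add_smul_right _ hb hm hH hG, lieBracket_add_smul_left _ ha hF hG,
    lieBracket_add_smul_left _ ha hF hG]
  simp only [lieBracket_self, Pi.zero_apply]
  refine ⟨fderiv ℝ b z (F z + a z • G z), fderiv ℝ m z (F z + a z • G z) -
    b z * fderiv ℝ a z (H z) - m z * fderiv ℝ a z (G z), ?_⟩
  module

/-- Negation commutes with `fderiv` unconditionally, so no differentiability is needed. -/
theorem lieBracket_lieBracket_swap (U V W : E3 → E3) (z : E3) :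
    lieBracket ℝ U (lieBracket ℝ V W) z = -lieBracket ℝ U (lieBracket ℝ W V) z := by
  have h : lieBracket ℝ V W = fun y => -lieBracket ℝ W V y := by
    funext y
    rw [lieBracket_swap]
  rw [h]
  generalize lieBracket ℝ W V = X
  simp only [lieBracket]
  rw [fderiv_fun_neg]
  simp only [neg_apply, map_neg]
  abel

/-- The effect of a feedback transformation on the iterated brackets at a point. -/
theorem feedback_brackets (hF : ContDiffAt ℝ ∞ F z) (hG : ContDiffAt ℝ ∞ G z)
    (ha : ContDiffAt ℝ ∞ a z) (hb : ContDiffAt ℝ ∞ b z)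
    (hF' : F' =ᶠ[𝓝 z] fun y => F y + a y • G y) (hG' : G' =ᶠ[𝓝 z] fun y => b y • G y) :
    ∃ m p q r s : ℝ,
      lieBracket ℝ G' F' z = b z • lieBracket ℝ G F z + m • G z ∧
      lieBracket ℝ G' (lieBracket ℝ G' F') z =
        b z ^ 2 • lieBracket ℝ G (lieBracket ℝ G F) z + p • lieBracket ℝ G F z + q • G z ∧
      lieBracket ℝ F' (lieBracket ℝ F' G') z =
        b z • lieBracket ℝ F (lieBracket ℝ F G) z -
          (b z * a z) • lieBracket ℝ G (lieBracket ℝ G F) z +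
          r • lieBracket ℝ G F z + s • G z := by
  have hH : lieBracket ℝ G' F' =ᶠ[𝓝 z]
      fun y => b y • lieBracket ℝ G F y + bracketShift F G a b y • G y := by
    filter_upwards [hG'.lieBracket_vectorField (𝕜 := ℝ) hF', eventually_differentiableAt hF,
      eventually_differentiableAt hG, eventually_differentiableAt ha,
      eventually_differentiableAt hb] with y hy h1 h2 h3 h4
    rw [hy, feedback_bracket h1 h2 h3 h4]
  have hm := contDiffAt_bracketShift hF hG ha hb
  have hB := contDiffAt_lieBracket hG hF
  obtain ⟨p, q, h1⟩ := feedback_control_bracket (diffAt hG) (diffAt hB) (diffAt hb) (diffAt hm)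
  obtain ⟨r, s, h2⟩ := feedback_drift_bracket (diffAt hF) (diffAt hG) (diffAt hB)
    (diffAt ha) (diffAt hb) (diffAt hm)
  refine ⟨_, p, q, -r + bracketShift F G a b z, -s, hH.eq_of_nhds, ?_, ?_⟩
  · rw [hG'.lieBracket_vectorField_eq hH, h1]
  · rw [lieBracket_lieBracket_swap, hF'.lieBracket_vectorField_eq hH, h2,
      lieBracket_lieBracket_swap F F G, lieBracket_swap (V := F) (W := G)]
    module

/-- The change of frame is triangular. The double bracket `[G',[G',F']]` has `F` component `b²λ₁`,
while `[F',[F',G']]` has leading part `b(k₃ - a)[G,[G,F]]`, to be measured against `b²[G,[G,F]]`. -/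
theorem feedback_structure (hF : ContDiffAt ℝ ∞ F z) (hG : ContDiffAt ℝ ∞ G z)
    (ha : ContDiffAt ℝ ∞ a z) (hb : ContDiffAt ℝ ∞ b z) (hbz : b z ≠ 0)
    (hF' : F' =ᶠ[𝓝 z] fun y => F y + a y • G y) (hG' : G' =ᶠ[𝓝 z] fun y => b y • G y)
    (h1 : A1At F G z) (h2 : A2At F G z) :
    eL F' G' 0 z = b z ^ 2 * eL F G 0 z ∧ eK F' G' 2 z = (eK F G 2 z - a z) / b z := by
  obtain ⟨m, p, q, r, s, e1, e2, e3⟩ := feedback_brackets hF hG ha hb hF' hG'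
  have i1 := linearIndependent_drift h1 hbz (a z) m
  have i2 := linearIndependent_control h2 hbz m p q
  rw [eL, eK, hF'.eq_of_nhds, hG'.eq_of_nhds, e3, e2, e1]
  constructor
  -- The two remaining coefficients come from back-substitution in the triangular system; they only
  -- serve to exhibit the full expansion. The same holds for `eK` below.
  · rw [frameCoord_three i1 finrank_E3 (a := b z ^ 2 * eL F G 0 z)
      (b := -b z * eL F G 0 z * a z + (b z ^ 2 * eL F G 1 z + q) / b z -
        (b z ^ 2 * eL F G 2 z + p) * m / b z ^ 2)
      (c := (b z ^ 2 * eL F G 2 z + p) / b z)]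
    · rfl
    · rw [eL_sum h1]
      match_scalars <;> field_simp
      ring
  · rw [frameCoord_three i2 finrank_E3
      (a := (b z * eK F G 0 z + s - (eK F G 2 z - a z) / b z * q -
        (b z * eK F G 1 z + r - (eK F G 2 z - a z) / b z * p) / b z * m) / b z)
      (b := (b z * eK F G 1 z + r - (eK F G 2 z - a z) / b z * p) / b z)
      (c := (eK F G 2 z - a z) / b z)]
    · rfl
    · rw [eK_sum h2]
      match_scalars <;> field_simp <;> ring

end Brackets

theorem frameCoord_zero {V : Type*} [AddCommGroup V] [Module ℝ V] (v : Fin 3 → V) (i : Fin 3) :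
    frameCoord v 0 i = 0 := by
  rw [frameCoord]
  split_ifs <;> simp

/-! ### Locality of the structure functions -/

section Congr

variable {F G F' G' : E3 → E3} {z : E3}

theorem eK_congr (hF : F' =ᶠ[𝓝 z] F) (hG : G' =ᶠ[𝓝 z] G) (i : Fin 3) :
    eK F' G' i z = eK F G i z := by
  have h1 := hG.lieBracket_vectorField (𝕜 := ℝ) hF
  have h2 := hF.lieBracket_vectorField (𝕜 := ℝ) hG
  rw [eK, eK, hG.eq_of_nhds, h1.eq_of_nhds, hG.lieBracket_vectorField_eq h1,
    hF.lieBracket_vectorField_eq h2]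

theorem eL_congr (hF : F' =ᶠ[𝓝 z] F) (hG : G' =ᶠ[𝓝 z] G) (i : Fin 3) :
    eL F' G' i z = eL F G i z := by
  have h1 := hG.lieBracket_vectorField (𝕜 := ℝ) hF
  rw [eL, eL, hF.eq_of_nhds, hG.eq_of_nhds, h1.eq_of_nhds, hG.lieBracket_vectorField_eq h1]

theorem eL_congr_eventually (hF : F' =ᶠ[𝓝 z] F) (hG : G' =ᶠ[𝓝 z] G) (i : Fin 3) :
    eL F' G' i =ᶠ[𝓝 z] eL F G i := by
  filter_upwards [hF.eventuallyEq_nhds, hG.eventuallyEq_nhds] with y h1 h2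
    using eL_congr h1 h2 i

end Congr

/-! ### Structure functions on the manifold and the canonical pair -/

section Charts

variable {M : Type*} [TopologicalSpace M] [ChartedSpace E3 M]

theorem contMDiffAt_of_chart (φ : PartialDiffeomorph (𝓡 3) (𝓡 3) M E3 ∞) {h : M → ℝ} {k : E3 → ℝ}
    {x : M} (hx : x ∈ φ.source) (hk : ContDiffAt ℝ ∞ k (φ x)) (hhk : ∀ y ∈ φ.source, h y = k (φ y)) :
    ContMDiffAt (𝓡 3) 𝓘(ℝ, ℝ) ∞ h x := by
  have h1 : ContMDiffAt (𝓡 3) 𝓘(ℝ, ℝ) ∞ (k ∘ φ) x :=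
    hk.contMDiffAt.comp x (φ.contMDiffOn.contMDiffAt (φ.open_source.mem_nhds hx))
  refine h1.congr_of_eventuallyEq ?_
  filter_upwards [φ.open_source.mem_nhds hx] with y hy using hhk y hy

variable [IsManifold (𝓡 3) ∞ M]

/-- The preferred chart at a point as a partial diffeomorphism. -/
def chartDiffeo (x : M) : PartialDiffeomorph (𝓡 3) (𝓡 3) M E3 ∞ where
  toPartialEquiv := (chartAt E3 x).toPartialEquiv
  open_source := (chartAt E3 x).open_source
  open_target := (chartAt E3 x).open_target
  contMDiffOn_toFun := contMDiffOn_chart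
  contMDiffOn_invFun := contMDiffOn_chart_symm

theorem mem_chartDiffeo_source (x : M) : x ∈ (chartDiffeo x).source := mem_chart_source E3 x

variable {f g : ∀ x : M, TangentSpace (𝓡 3) x}

theorem structK_eq (φ : PartialDiffeomorph (𝓡 3) (𝓡 3) M E3 ∞) (hf : IsSmoothVectorField f)
    (hg : IsSmoothVectorField g) (i : Fin 3) {x : M} (hx : x ∈ φ.source) :
    structK f g i x = eK (push φ f) (push φ g) i (φ x) := by
  rw [eK_push φ hf hg i (apply_mem φ hx), symm_apply_self φ hx]

theorem structL_eq (φ : PartialDiffeomorph (𝓡 3) (𝓡 3) M E3 ∞) (hf : IsSmoothVectorField f)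
    (hg : IsSmoothVectorField g) (i : Fin 3) {x : M} (hx : x ∈ φ.source) :
    structL f g i x = eL (push φ f) (push φ g) i (φ x) := by
  rw [eL_push φ hf hg i (apply_mem φ hx), symm_apply_self φ hx]

theorem contMDiff_structK (hf : IsSmoothVectorField f) (hg : IsSmoothVectorField g)
    (hA : AssumptionA2 f g) (i : Fin 3) : ContMDiff (𝓡 3) 𝓘(ℝ, ℝ) ∞ (structK f g i) := by
  intro x
  have hx := mem_chartDiffeo_source x
  have hz := apply_mem _ hx
  exact contMDiffAt_of_chart _ hx (contDiffAt_eK (push_contDiffAt _ hf hz)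
    (push_contDiffAt _ hg hz) (a2At_push _ hf hg hA hz) i)
    fun y hy => structK_eq _ hf hg i hy

theorem contMDiff_structL (hf : IsSmoothVectorField f) (hg : IsSmoothVectorField g)
    (hA : AssumptionA1 f g) (i : Fin 3) : ContMDiff (𝓡 3) 𝓘(ℝ, ℝ) ∞ (structL f g i) := by
  intro x
  have hx := mem_chartDiffeo_source x
  have hz := apply_mem _ hx
  exact contMDiffAt_of_chart _ hx (contDiffAt_eL (push_contDiffAt _ hf hz)
    (push_contDiffAt _ hg hz) (a1At_push _ hf hg hA hz) i)
    fun y hy => structL_eq _ hf hg i hy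

theorem structL_zero_ne_zero (hf : IsSmoothVectorField f) (hg : IsSmoothVectorField g)
    (hA1 : AssumptionA1 f g) (hA2 : AssumptionA2 f g) (x : M) : structL f g 0 x ≠ 0 := by
  have hx := mem_chartDiffeo_source x
  have hz := apply_mem _ hx
  rw [structL_eq _ hf hg 0 hx]
  exact eL_zero_ne_zero (a1At_push _ hf hg hA1 hz) (a2At_push _ hf hg hA2 hz)

/-- The transformation law of `k₃` and `λ₁` under feedback. -/
theorem feedback_struct (hf : IsSmoothVectorField f) (hg : IsSmoothVectorField g)
    (hA1 : AssumptionA1 f g) (hA2 : AssumptionA2 f g) {a b : M → ℝ}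
    (ha : ContMDiff (𝓡 3) 𝓘(ℝ, ℝ) ∞ a) (hb : ContMDiff (𝓡 3) 𝓘(ℝ, ℝ) ∞ b)
    (hb0 : ∀ x, b x ≠ 0) {f' g' : ∀ x : M, TangentSpace (𝓡 3) x}
    (hf' : IsSmoothVectorField f') (hg' : IsSmoothVectorField g')
    (hff : ∀ x, f' x = f x + a x • g x) (hgg : ∀ x, g' x = b x • g x) (x : M) :
    structL f' g' 0 x = b x ^ 2 * structL f g 0 x ∧
      structK f' g' 2 x = (structK f g 2 x - a x) / b x := by
  have hx := mem_chartDiffeo_source x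
  set φ := chartDiffeo x
  have hz := apply_mem φ hx
  have hs : ∀ {c : M → ℝ}, ContMDiff (𝓡 3) 𝓘(ℝ, ℝ) ∞ c →
      ContDiffAt ℝ ∞ (fun y => c (φ.symm y)) (φ x) := fun hc =>
    (hc.contMDiffAt.comp _ (symm_contMDiffAt φ hz)).contDiffAt
  have hF : push φ f' =ᶠ[𝓝 (φ x)] fun y => push φ f y + a (φ.symm y) • push φ g y := by
    filter_upwards [φ.open_target.mem_nhds hz] with y hy
    rw [push_eq_symm φ _ hy, push_eq_symm φ _ hy, push_eq_symm φ _ hy, hff]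
    simp
  have hG : push φ g' =ᶠ[𝓝 (φ x)] fun y => b (φ.symm y) • push φ g y := by
    filter_upwards [φ.open_target.mem_nhds hz] with y hy
    rw [push_eq_symm φ _ hy, push_eq_symm φ _ hy, hgg]
    simp
  have key := feedback_structure (push_contDiffAt φ hf hz) (push_contDiffAt φ hg hz) (hs ha) (hs hb)
    (hb0 _) hF hG (a1At_push φ hf hg hA1 hz) (a2At_push φ hf hg hA2 hz)
  rw [symm_apply_self φ hx, ← structL_eq φ hf' hg' 0 hx, ← structL_eq φ hf hg 0 hx,
    ← structK_eq φ hf' hg' 2 hx, ← structK_eq φ hf hg 2 hx] at key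
  exact key

/-- By `feedback_struct`, `α = k₃` makes the new `k₃` vanish and `β² = |λ₁|⁻¹` turns `λ₁` into its
sign; `λ₁ ≠ 0` keeps `β` smooth. -/
theorem isCanonicalPairOf_canonical (hf : IsSmoothVectorField f) (hg : IsSmoothVectorField g)
    (hA1 : AssumptionA1 f g) (hA2 : AssumptionA2 f g) :
    IsCanonicalPairOf f g (canonicalDrift f g) (canonicalControl f g) := by
  have hk := contMDiff_structK hf hg hA2 2
  have h0 := structL_zero_ne_zero hf hg hA1 hA2
  have hpos : ∀ x, 0 < |structL f g 0 x| := fun x => abs_pos.2 (h0 x)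
  have hb0 : ∀ x, (Real.sqrt |structL f g 0 x|)⁻¹ ≠ 0 := fun x =>
    inv_ne_zero (Real.sqrt_pos.2 (hpos x)).ne'
  have hb : ContMDiff (𝓡 3) 𝓘(ℝ, ℝ) ∞ (fun x => (Real.sqrt |structL f g 0 x|)⁻¹) := by
    intro x
    have h1 : ContDiffAt ℝ ∞ (fun t : ℝ => (Real.sqrt |t|)⁻¹) (structL f g 0 x) :=
      ((contDiffAt_abs (h0 x)).sqrt (hpos x).ne').inv (Real.sqrt_pos.2 (hpos x)).ne'
    exact h1.contMDiffAt.comp x (contMDiff_structL hf hg hA1 0 x)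
  have hfc : IsSmoothVectorField (canonicalDrift f g) := ContMDiff.add_section hf (hk.smul_section hg)
  have hgc : IsSmoothVectorField (canonicalControl f g) := hb.smul_section hg
  have key := feedback_struct hf hg hA1 hA2 hk hb hb0 hfc hgc (fun _ => rfl) (fun _ => rfl)
  refine ⟨hfc, hgc, ⟨_, _, hk, hb, fun x => ⟨hb0 x, rfl, rfl⟩⟩, fun x => ?_, fun x => ?_⟩
  · rw [(key x).2, sub_self, zero_div]
  · rw [(key x).1, inv_pow, Real.sq_sqrt (abs_nonneg _)]
    rcases abs_cases (structL f g 0 x) with ⟨h, _⟩ | ⟨h, _⟩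
    · left
      rw [h, inv_mul_cancel₀ (h0 x)]
    · right
      rw [h, inv_neg, neg_mul, inv_mul_cancel₀ (h0 x)]

end Charts

/-! ### Fields depending only on the last coordinate, and trivial systems -/

/-- A map on `ℝ³` that depends only on the last coordinate. -/
def DependsOnLast {E : Type*} (V : E3 → E) : Prop := ∀ y y' : E3, y 2 = y' 2 → V y = V y'

section DependsOnLast

variable {E : Type*} [NormedAddCommGroup E] [NormedSpace ℝ E]

/-- The map is constant along lines in direction `v`; where it is not differentiable, `fderiv` is
`0` by default. -/
theorem DependsOnLast.fderiv_eq_zero {V : E3 → E} (hV : DependsOnLast V) (y : E3) {v : E3}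
    (hv : v 2 = 0) : fderiv ℝ V y v = 0 := by
  by_cases hd : DifferentiableAt ℝ V y
  · rw [← hd.lineDeriv_eq_fderiv, lineDeriv]
    have : (fun t : ℝ => V (y + t • v)) = fun _ => V y := by
      funext t
      exact hV _ _ (by simp [hv])
    rw [this, deriv_const]
  · rw [fderiv_zero_of_not_differentiableAt hd]
    rfl

/-- Translation by `y' - y` has zero last component and so leaves `V` unchanged; hence the
derivatives at the two points agree. -/
theorem DependsOnLast.fderiv {V : E3 → E} (hV : DependsOnLast V) :
    DependsOnLast (fderiv ℝ V) := by
  intro y y' h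
  have h1 : (fun x => V (x + (y' - y))) = V := by
    funext x
    exact hV _ _ (by simp [h])
  have h2 := fderiv_comp_add_right (𝕜 := ℝ) (f := V) (x := y) (y' - y)
  rw [h1, add_sub_cancel] at h2
  exact h2

theorem DependsOnLast.lieBracket {V W : E3 → E3} (hV : DependsOnLast V) (hW : DependsOnLast W) :
    DependsOnLast (lieBracket ℝ V W) := by
  intro y y' h
  simp only [VectorField.lieBracket]
  rw [hV _ _ h, hW _ _ h, hV.fderiv _ _ h, hW.fderiv _ _ h]

theorem DependsOnLast.eL {F G : E3 → E3} (hF : DependsOnLast F) (hG : DependsOnLast G)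
    (i : Fin 3) : DependsOnLast (eL F G i) := by
  intro y y' h
  rw [TrivialControl.eL, TrivialControl.eL, hF _ _ h, hG _ _ h, (hG.lieBracket hF) _ _ h,
    (hG.lieBracket (hG.lieBracket hF)) _ _ h]

theorem DependsOnLast.lieBracket_eq_zero {V W : E3 → E3} (hV : DependsOnLast V)
    (hW : DependsOnLast W) {y : E3} (h1 : V y 2 = 0) (h2 : W y 2 = 0) :
    VectorField.lieBracket ℝ V W y = 0 := by
  rw [VectorField.lieBracket, hV.fderiv_eq_zero y h2, hW.fderiv_eq_zero y h1, sub_zero]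

end DependsOnLast

section TrivialSystem

/-- The drift of a trivial system as a map on `ℝ³`. -/
def eDrift (F₁ F₂ : ℝ → ℝ) (z : E3) : E3 := !₂[F₁ (z 2), F₂ (z 2), 0]

/-- The control field of a trivial system as a map on `ℝ³`. -/
def eControl (_ : E3) : E3 := !₂[0, 0, 1]

variable {F₁ F₂ : ℝ → ℝ}

theorem eDrift_dependsOnLast (F₁ F₂ : ℝ → ℝ) :
    DependsOnLast (eDrift F₁ F₂) := by
  intro y y' h
  simp only [eDrift, h]

theorem eDrift_last (F₁ F₂ : ℝ → ℝ) (y : E3) : eDrift F₁ F₂ y 2 = 0 := rfl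

theorem contDiff_eDrift (h1 : ContDiff ℝ ∞ F₁) (h2 : ContDiff ℝ ∞ F₂) :
    ContDiff ℝ ∞ (eDrift F₁ F₂) := by
  have hp : ContDiff ℝ ∞ (fun y : E3 => y 2) := (EuclideanSpace.proj 2 : E3 →L[ℝ] ℝ).contDiff
  rw [contDiff_euclidean]
  intro i
  fin_cases i
  · exact h1.comp hp
  · exact h2.comp hp
  · exact contDiff_const

/-- Only the derivative of the drift along `G` survives, and the last component of the drift is
constantly `0`. -/
theorem lieBracket_eDrift_last (h1 : ContDiff ℝ ∞ F₁) (h2 : ContDiff ℝ ∞ F₂) {G : E3 → E3}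
    (hG : DependsOnLast G) (y : E3) :
    lieBracket ℝ (eDrift F₁ F₂) G y 2 = 0 := by
  rw [lieBracket, hG.fderiv_eq_zero y (eDrift_last F₁ F₂ y), zero_sub]
  have hd : DifferentiableAt ℝ (eDrift F₁ F₂) y :=
    (contDiff_eDrift h1 h2).contDiffAt.differentiableAt (by simp)
  have h3 : HasFDerivAt (fun y : E3 => eDrift F₁ F₂ y 2) _ y :=
    (EuclideanSpace.proj 2 : E3 →L[ℝ] ℝ).hasFDerivAt.comp y hd.hasFDerivAt
  have h4 : HasFDerivAt (fun y : E3 => eDrift F₁ F₂ y 2) (0 : E3 →L[ℝ] ℝ) y :=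
    hasFDerivAt_const _ _
  have h5 := congrArg (fun L => L (G y)) (h3.unique h4)
  simpa using h5

theorem lieBracket_lieBracket_eDrift (h1 : ContDiff ℝ ∞ F₁) (h2 : ContDiff ℝ ∞ F₂)
    {G : E3 → E3} (hG : DependsOnLast G) (y : E3) :
    lieBracket ℝ (eDrift F₁ F₂)
      (lieBracket ℝ (eDrift F₁ F₂) G) y = 0 :=
  (eDrift_dependsOnLast F₁ F₂).lieBracket_eq_zero
    ((eDrift_dependsOnLast F₁ F₂).lieBracket hG) (eDrift_last F₁ F₂ y)
    (lieBracket_eDrift_last h1 h2 hG y)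

/-- The double bracket is `0`, and `frameCoord` sends `0` to `0` even for a dependent family, so no
frame condition is required. -/
theorem eK_eDrift (h1 : ContDiff ℝ ∞ F₁) (h2 : ContDiff ℝ ∞ F₂) {G : E3 → E3}
    (hG : DependsOnLast G) (i : Fin 3) (y : E3) :
    eK (eDrift F₁ F₂) G i y = 0 := by
  rw [eK, lieBracket_lieBracket_eDrift h1 h2 hG y, frameCoord_zero]

theorem eControl_dependsOnLast : DependsOnLast eControl :=
  fun _ _ _ => rfl

/-- A canonical pair on an open set that is feedback equivalent to a trivial system agrees near
each point with a pair of vector fields depending only on the last coordinate. -/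
theorem canonical_eventuallyEq_dependsOnLast (h1 : ContDiff ℝ ∞ F₁) (h2 : ContDiff ℝ ∞ F₂)
    {Fc Gc : E3 → E3} {a b : E3 → ℝ} {U : Set E3} (hU : IsOpen U)
    (hF : ∀ z ∈ U, ContDiffAt ℝ ∞ Fc z) (hG : ∀ z ∈ U, ContDiffAt ℝ ∞ Gc z)
    (ha : ∀ z ∈ U, ContDiffAt ℝ ∞ a z) (hb : ∀ z ∈ U, ContDiffAt ℝ ∞ b z)
    (hb0 : ∀ z ∈ U, b z ≠ 0)
    (hK : ∀ z ∈ U, eK Fc Gc 2 z = 0) (hL : ∀ z ∈ U, eL Fc Gc 0 z = 1 ∨ eL Fc Gc 0 z = -1)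
    (hT : ∀ z ∈ U, eDrift F₁ F₂ z = Fc z + a z • Gc z)
    (hW : ∀ z ∈ U, eControl z = b z • Gc z) {z : E3} (hz : z ∈ U) :
    ∃ G : E3 → E3, DependsOnLast G ∧ Gc =ᶠ[𝓝 z] G ∧
      Fc =ᶠ[𝓝 z] (eDrift F₁ F₂) := by
  set T : E3 → E3 := eDrift F₁ F₂ with hTdef
  set W : E3 → E3 := eControl with hWdef
  have hL0 : ∀ y ∈ U, eL Fc Gc 0 y ≠ 0 := by
    intro y hy h
    rcases hL y hy with h' | h' <;> rw [h] at h' <;> norm_num at h'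
  -- Both pairs have `k₃ = 0`, so the law for `k₃` leaves `a = 0`; the law for `λ₁` then determines
  -- `b` up to sign.
  have key : ∀ y ∈ U, eL T W 0 y = b y ^ 2 * eL Fc Gc 0 y ∧ a y = 0 := by
    intro y hy
    have e1 : T =ᶠ[𝓝 y] fun y => Fc y + a y • Gc y := by
      filter_upwards [hU.mem_nhds hy] using hT
    have e2 : W =ᶠ[𝓝 y] fun y => b y • Gc y := by
      filter_upwards [hU.mem_nhds hy] using hW
    obtain ⟨k1, k2⟩ := feedback_structure (hF y hy) (hG y hy) (ha y hy) (hb y hy) (hb0 y hy) e1 e2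
      (a1At_of_eL_ne_zero (hL0 y hy)) (a2At_of_eL_ne_zero (hL0 y hy))
    refine ⟨k1, ?_⟩
    rw [eK_eDrift h1 h2 eControl_dependsOnLast, hK y hy, eq_comm,
      div_eq_zero_iff] at k2
    rcases k2 with k2 | k2
    · linarith
    · exact absurd k2 (hb0 y hy)
  have habs : ∀ y ∈ U, Real.sqrt |eL T W 0 y| = |b y| := by
    intro y hy
    rw [(key y hy).1, abs_mul]
    rcases hL y hy with h | h <;> rw [h] <;> simp [Real.sqrt_sq_eq_abs]
  have hFT : Fc =ᶠ[𝓝 z] T := by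
    filter_upwards [hU.mem_nhds hz] with y hy
    rw [hT y hy, (key y hy).2, zero_smul, add_zero]
  -- The scalar `s` will be the sign of `b`, which is locally constant because `b` is continuous and
  -- nonzero.
  have hdep : ∀ s : ℝ, DependsOnLast (fun y => (s * Real.sqrt |eL T W 0 y|)⁻¹ • W y) := by
    intro s y y' h
    change (s * Real.sqrt |eL T W 0 y|)⁻¹ • W y = (s * Real.sqrt |eL T W 0 y'|)⁻¹ • W y'
    have e1 : eL T W 0 y = eL T W 0 y' :=
      (eDrift_dependsOnLast F₁ F₂).eL eControl_dependsOnLast 0 y y' h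
    have e2 : W y = W y' := eControl_dependsOnLast y y' h
    rw [e1, e2]
  have hGW : ∀ y ∈ U, Gc y = (b y)⁻¹ • W y := by
    intro y hy
    rw [hW y hy, smul_smul, inv_mul_cancel₀ (hb0 y hy), one_smul]
  rcases lt_or_gt_of_ne (hb0 z hz) with hs | hs
  · refine ⟨_, hdep (-1), ?_, hFT⟩
    filter_upwards [hU.mem_nhds hz, (hb z hz).continuousAt.eventually (gt_mem_nhds hs)] with y hy hby
    rw [habs y hy, abs_of_neg hby, hGW y hy]
    simp
  · refine ⟨_, hdep 1, ?_, hFT⟩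
    filter_upwards [hU.mem_nhds hz, (hb z hz).continuousAt.eventually (lt_mem_nhds hs)] with y hy hby
    rw [habs y hy, abs_of_pos hby, hGW y hy]
    simp

end TrivialSystem

/-- The feedback `(α, β)` on `(f, g)` becomes `((α - a)/b, β/b)` on the canonical pair `(f + ag,
bg)`. -/
theorem feedback_drift_transition {V : Type*} [AddCommGroup V] [Module ℝ V] (u v : V) (a α : ℝ)
    {b : ℝ} (hb : b ≠ 0) : u + α • v = u + a • v + ((α - a) / b) • b • v := by
  rw [smul_smul, div_mul_cancel₀ _ hb]
  module

theorem feedback_control_transition {V : Type*} [AddCommGroup V] [Module ℝ V] (v : V) (β : ℝ)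
    {b : ℝ} (hb : b ≠ 0) : β • v = (β / b) • b • v := by
  rw [smul_smul, div_mul_cancel₀ _ hb]

/-! ### Necessity of the conditions -/

section Manifold

variable {M : Type*} [TopologicalSpace M] [ChartedSpace E3 M] [IsManifold (𝓡 3) ∞ M]
  {f g fc gc : ∀ x : M, TangentSpace (𝓡 3) x}

theorem trivialityConditions_of_locallyTrivialisable (hc : IsCanonicalPairOf f g fc gc) {x₀ : M}
    (h : LocallyTrivialisableAt f g x₀) : ∀ᶠ x in 𝓝 x₀, TrivialityConditionsAt fc gc x := by
  obtain ⟨hfc, hgc, ⟨a, b, ha, hb, hab⟩, hK, hL⟩ := hc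
  obtain ⟨F₁, F₂, z₀, h1, h2, φ, α, β, hx₀, -, hα, hβ, hφ⟩ := h
  filter_upwards [φ.open_source.mem_nhds hx₀] with x hx
  have hs : ∀ {c : M → ℝ}, ContMDiffOn (𝓡 3) 𝓘(ℝ, ℝ) ∞ c φ.source → ∀ z ∈ φ.target,
      ContDiffAt ℝ ∞ (fun y => c (φ.symm y)) z := fun hc z hz =>
    ((hc.contMDiffAt (φ.open_source.mem_nhds (symm_mem φ hz))).comp _
      (symm_contMDiffAt φ hz)).contDiffAt
  have hb0 : ∀ z ∈ φ.target, b (φ.symm z) ≠ 0 := fun z _ => (hab _).1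
  have hφ' : ∀ z ∈ φ.target,
      eDrift F₁ F₂ z = push φ (fun x => f x + α x • g x) z ∧
      eControl z = push φ (fun x => β x • g x) z := by
    intro z hz
    obtain ⟨-, e1, e2⟩ := hφ _ (symm_mem φ hz)
    rw [← push_apply φ (fun x => f x + α x • g x) (symm_mem φ hz), apply_symm_self φ hz] at e1
    rw [← push_apply φ (fun x => β x • g x) (symm_mem φ hz), apply_symm_self φ hz] at e2
    exact ⟨e1, e2⟩
  have hz := apply_mem φ hx
  obtain ⟨G, hG, eG, eF⟩ := canonical_eventuallyEq_dependsOnLast h1 h2 φ.open_target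
    (Fc := push φ fc) (Gc := push φ gc)
    (a := fun z => (α (φ.symm z) - a (φ.symm z)) / b (φ.symm z))
    (b := fun z => β (φ.symm z) / b (φ.symm z))
    (fun z hz => push_contDiffAt φ hfc hz) (fun z hz => push_contDiffAt φ hgc hz)
    (fun z hz => ((hs hα z hz).sub (hs ha.contMDiffOn z hz)).div (hs hb.contMDiffOn z hz)
      (hb0 z hz))
    (fun z hz => (hs hβ z hz).div (hs hb.contMDiffOn z hz) (hb0 z hz))
    (fun z hz => div_ne_zero (hφ _ (symm_mem φ hz)).1 (hb0 z hz))
    (fun z hz => by rw [eK_push φ hfc hgc 2 hz, hK])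
    (fun z hz => by rw [eL_push φ hfc hgc 0 hz]; exact hL _)
    (fun z hz => by
      rw [(hφ' z hz).1]
      simp only [push_eq_symm φ _ hz, (hab _).2.1, (hab _).2.2]
      simp only [map_add, map_smul]
      exact feedback_drift_transition _ _ _ _ (hb0 z hz))
    (fun z hz => by
      rw [(hφ' z hz).2]
      simp only [push_eq_symm φ _ hz, (hab _).2.2]
      simp only [map_smul]
      exact feedback_control_transition _ _ (hb0 z hz))
    hz
  set T : E3 → E3 := eDrift F₁ F₂ with hT
  have hTd : DependsOnLast T := eDrift_dependsOnLast F₁ F₂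
  have hL0 : eL (push φ fc) (push φ gc) 0 (φ x) ≠ 0 := by
    rw [eL_push φ hfc hgc 0 hz]
    rcases hL (φ.symm (φ x)) with h | h <;> rw [h] <;> norm_num
  have hν := (contDiffAt_eL (push_contDiffAt φ hfc hz) (push_contDiffAt φ hgc hz)
    (a1At_of_eL_ne_zero hL0) 2).differentiableAt (by simp)
  have hlie : ∀ (v : ∀ x : M, TangentSpace (𝓡 3) x), push φ v (φ x) 2 = 0 →
      lieDeriv v (centroAffineCurvature fc gc) x = 0 := by
    intro v hv
    have := lieDeriv_push φ v hz hν (h := centroAffineCurvature fc gc)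
      (fun y hy => (eL_push φ hfc hgc 2 hy).symm)
    rw [symm_apply_self φ hx] at this
    -- Near this point the local expression of `ν` agrees with a function of the last coordinate, so
    -- a direction without last component kills it.
    rw [this, (eL_congr_eventually eF eG 2).fderiv_eq]
    exact (hTd.eL hG 2).fderiv_eq_zero _ hv
  refine ⟨?_, hlie _ ?_, hlie _ ?_⟩
  · rw [curvature, structK_eq φ hfc hgc 0 hx, eK_congr eF eG, eK_eDrift h1 h2 hG]
  · rw [eF.eq_of_nhds]
    exact eDrift_last F₁ F₂ _
  · rw [push_bracket φ hfc hgc hz, eF.lieBracket_vectorField_eq eG]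
    exact lieBracket_eDrift_last h1 h2 hG _

end Manifold

/-! ### Closed one-forms prescribed on a frame -/

/-- The `1`-form with values `p, r, q` on the frame `F, G, H`. -/
def dualForm (F G H : E3 → E3) (p r q : E3 → ℝ) (y : E3) : E3 →L[ℝ] ℝ :=
  (p y • (EuclideanSpace.proj 0 : E3 →L[ℝ] ℝ) + r y • (EuclideanSpace.proj 1 : E3 →L[ℝ] ℝ) +
    q y • (EuclideanSpace.proj 2 : E3 →L[ℝ] ℝ)) ∘L (frameMap ![F y, G y, H y]).inverse

section DualForm

variable {F G H : E3 → E3} {p r q : E3 → ℝ} {z : E3}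

theorem dualForm_apply (h : LinearIndependent ℝ ![F z, G z, H z]) (a b c : ℝ) :
    dualForm F G H p r q z (a • F z + b • G z + c • H z) = a * p z + b * r z + c * q z := by
  have hc := frameCoord_three h finrank_E3 (a := a) (b := b) (c := c) rfl
  have e0 := frameCoord_eq_inverse h (a • F z + b • G z + c • H z) 0
  have e1 := frameCoord_eq_inverse h (a • F z + b • G z + c • H z) 1
  have e2 := frameCoord_eq_inverse h (a • F z + b • G z + c • H z) 2
  rw [hc] at e0 e1 e2
  change p z * (frameMap ![F z, G z, H z]).inverse (a • F z + b • G z + c • H z) 0 +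
    r z * (frameMap ![F z, G z, H z]).inverse (a • F z + b • G z + c • H z) 1 +
    q z * (frameMap ![F z, G z, H z]).inverse (a • F z + b • G z + c • H z) 2 = _
  rw [← e0, ← e1, ← e2]
  change p z * a + r z * b + q z * c = _
  ring

theorem dualForm_fst (h : LinearIndependent ℝ ![F z, G z, H z]) :
    dualForm F G H p r q z (F z) = p z := by
  simpa using dualForm_apply (p := p) (r := r) (q := q) h 1 0 0

theorem dualForm_snd (h : LinearIndependent ℝ ![F z, G z, H z]) :
    dualForm F G H p r q z (G z) = r z := by
  simpa using dualForm_apply (p := p) (r := r) (q := q) h 0 1 0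

theorem dualForm_thd (h : LinearIndependent ℝ ![F z, G z, H z]) :
    dualForm F G H p r q z (H z) = q z := by
  simpa using dualForm_apply (p := p) (r := r) (q := q) h 0 0 1

theorem contDiffAt_dualForm (hF : ContDiffAt ℝ ∞ F z) (hG : ContDiffAt ℝ ∞ G z)
    (hH : ContDiffAt ℝ ∞ H z) (h : LinearIndependent ℝ ![F z, G z, H z])
    (hp : ContDiffAt ℝ ∞ p z) (hr : ContDiffAt ℝ ∞ r z) (hq : ContDiffAt ℝ ∞ q z) :
    ContDiffAt ℝ ∞ (dualForm F G H p r q) z :=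
  (((hp.smul contDiffAt_const).add (hr.smul contDiffAt_const)).add
    (hq.smul contDiffAt_const)).clm_comp (contDiffAt_inverse_frameMap hF hG hH h)

end DualForm

/-- The Cartan formula for the exterior derivative of a `1`-form. -/
theorem fderiv_form_sub {θ : E3 → E3 →L[ℝ] ℝ} {V W : E3 → E3} {z : E3}
    (hθ : DifferentiableAt ℝ θ z) (hV : DifferentiableAt ℝ V z) (hW : DifferentiableAt ℝ W z) :
    fderiv ℝ θ z (V z) (W z) - fderiv ℝ θ z (W z) (V z) =
      fderiv ℝ (fun y => θ y (W y)) z (V z) - fderiv ℝ (fun y => θ y (V y)) z (W z) -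
        θ z (lieBracket ℝ V W z) := by
  rw [fderiv_clm_apply hθ hW, fderiv_clm_apply hθ hV, lieBracket]
  simp
  ring

/-- Reduces closedness of a one-form to the three pairs of frame fields. -/
theorem symm_of_frame {B : E3 →L[ℝ] E3 →L[ℝ] ℝ} {x y w : E3}
    (h : LinearIndependent ℝ ![x, y, w]) (hxy : B x y = B y x) (hxw : B x w = B w x)
    (hyw : B y w = B w y) (u v : E3) : B u v = B v u := by
  rw [frameCoord_three_sum h finrank_E3 u, frameCoord_three_sum h finrank_E3 v]
  simp only [map_add, map_smul, add_apply, smul_apply, smul_eq_mul, hxy, hxw, hyw]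
  ring

/-- A pair of functions on a ball equipped with a frame `F, G, H = [G,F]` with `[F,H] = 0` and
`[G,H] = εF + νH` that are values of a closed `1`-form with constant value on `G`. -/
theorem exists_primitive {F G H : E3 → E3} {ν p q : E3 → ℝ} {ε r : ℝ} {z₀ : E3} {ρ : ℝ}
    (hF : ∀ z ∈ Metric.ball z₀ ρ, ContDiffAt ℝ ∞ F z)
    (hG : ∀ z ∈ Metric.ball z₀ ρ, ContDiffAt ℝ ∞ G z)
    (hH : ∀ z ∈ Metric.ball z₀ ρ, ContDiffAt ℝ ∞ H z)
    (hli : ∀ z ∈ Metric.ball z₀ ρ, LinearIndependent ℝ ![F z, G z, H z])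
    (hFG : ∀ z ∈ Metric.ball z₀ ρ, lieBracket ℝ F G z = -H z)
    (hFH : ∀ z ∈ Metric.ball z₀ ρ, lieBracket ℝ F H z = 0)
    (hGH : ∀ z ∈ Metric.ball z₀ ρ, lieBracket ℝ G H z = ε • F z + ν z • H z)
    (hp : ∀ z ∈ Metric.ball z₀ ρ, ContDiffAt ℝ ∞ p z)
    (hq : ∀ z ∈ Metric.ball z₀ ρ, ContDiffAt ℝ ∞ q z)
    (hGp : ∀ z ∈ Metric.ball z₀ ρ, fderiv ℝ p z (G z) = q z)
    (hFq : ∀ z ∈ Metric.ball z₀ ρ, fderiv ℝ q z (F z) = fderiv ℝ p z (H z))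
    (hGq : ∀ z ∈ Metric.ball z₀ ρ, fderiv ℝ q z (G z) = ε * p z + ν z * q z) :
    ∃ P : E3 → ℝ, ∀ z ∈ Metric.ball z₀ ρ, ContDiffAt ℝ ∞ P z ∧ fderiv ℝ P z (F z) = p z ∧
      fderiv ℝ P z (G z) = r ∧ fderiv ℝ P z (H z) = q z := by
  set θ := dualForm F G H p (fun _ => r) q with hθdef
  have hθ : ∀ z ∈ Metric.ball z₀ ρ, ContDiffAt ℝ ∞ θ z := fun z hz =>
    contDiffAt_dualForm (hF z hz) (hG z hz) (hH z hz) (hli z hz) (hp z hz) contDiffAt_const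
      (hq z hz)
  have hop : IsOpen (Metric.ball z₀ ρ) := Metric.isOpen_ball
  have hθd : DifferentiableOn ℝ θ (Metric.ball z₀ ρ) := fun z hz =>
    (diffAt (hθ z hz)).differentiableWithinAt
  obtain ⟨P, hP⟩ := (convex_ball z₀ ρ).exists_forall_hasFDerivAt_of_fderiv_symmetric hop hθd (by
      intro z hz
      have d := diffAt (hθ z hz)
      have eF : (fun y => θ y (F y)) =ᶠ[𝓝 z] p := by
        filter_upwards [hop.mem_nhds hz] with y hy using dualForm_fst (hli y hy)
      have eG : (fun y => θ y (G y)) =ᶠ[𝓝 z] fun _ => r := by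
        filter_upwards [hop.mem_nhds hz] with y hy using dualForm_snd (hli y hy)
      have eH : (fun y => θ y (H y)) =ᶠ[𝓝 z] q := by
        filter_upwards [hop.mem_nhds hz] with y hy using dualForm_thd (hli y hy)
      -- With `dθ` evaluated by Cartan's formula, the three values are `-G(p) + q`, `F(q) - H(p)`
      -- and `G(q) - εp - νq`; each vanishes by hypothesis.
      have k1 := fderiv_form_sub d (diffAt (hF z hz)) (diffAt (hG z hz))
      have k2 := fderiv_form_sub d (diffAt (hF z hz)) (diffAt (hH z hz))
      have k3 := fderiv_form_sub d (diffAt (hG z hz)) (diffAt (hH z hz))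
      rw [eF.fderiv_eq, eG.fderiv_eq, hFG z hz, map_neg, eH.eq_of_nhds, hGp z hz] at k1
      rw [eF.fderiv_eq, eH.fderiv_eq, hFH z hz, map_zero, hFq z hz] at k2
      rw [eG.fderiv_eq, eH.fderiv_eq, hGH z hz, map_add, map_smul, map_smul, eH.eq_of_nhds,
        eF.eq_of_nhds, hGq z hz] at k3
      simp only [fderiv_fun_const, Pi.zero_apply, zero_apply, smul_eq_mul] at k1 k2 k3
      exact symm_of_frame (hli z hz) (by linarith) (by linarith) (by linarith))
  -- The Poincaré lemma gives only a differentiable `P`; smoothness follows because its derivative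
  -- is the smooth form `θ`.
  have hP' : ContDiffOn ℝ ∞ P (Metric.ball z₀ ρ) := by
    rw [contDiffOn_infty_iff_fderiv_of_isOpen hop]
    refine ⟨fun z hz => (hP z hz).differentiableAt.differentiableWithinAt, ?_⟩
    exact ContDiffOn.congr (fun z hz => (hθ z hz).contDiffWithinAt) fun z hz => (hP z hz).fderiv
  refine ⟨P, fun z hz => ⟨hP'.contDiffAt (hop.mem_nhds hz), ?_, ?_, ?_⟩⟩ <;>
    rw [(hP z hz).fderiv]
  · exact dualForm_fst (hli z hz)
  · exact dualForm_snd (hli z hz)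
  · exact dualForm_thd (hli z hz)

/-! ### Inverse function theorem, globalisation and a linear ODE -/

theorem isInvertible_of_frame {L : E3 →L[ℝ] E3} {x y w : E3}
    (h : LinearIndependent ℝ ![x, y, w]) (h' : LinearIndependent ℝ ![L x, L y, L w]) :
    L.IsInvertible := by
  have hinj : Function.Injective L.toLinearMap := by
    rw [← LinearMap.ker_eq_bot, LinearMap.ker_eq_bot']
    intro u hu
    have hs := frameCoord_three_sum h finrank_E3 u
    obtain ⟨h0, h1, h2⟩ := (linearIndependent_three_iff _ _ _).1 h' _ _ _
      (show frameCoord ![x, y, w] u 0 • L x + frameCoord ![x, y, w] u 1 • L y +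
        frameCoord ![x, y, w] u 2 • L w = 0 by
        rw [← map_smul, ← map_smul, ← map_smul, ← map_add, ← map_add, ← hs]
        exact hu)
    rw [hs, h0, h1, h2]
    simp
  refine ⟨(LinearEquiv.ofInjectiveEndo _ hinj).toContinuousLinearEquiv, ?_⟩
  ext1 c
  rfl

/-- The inverse function theorem, with a smooth inverse on an open set. -/
theorem exists_partialDiffeomorph {Φ : E3 → E3} {z₀ : E3} {U : Set E3} (hU : IsOpen U)
    (hz₀ : z₀ ∈ U) (hΦ : ∀ z ∈ U, ContDiffAt ℝ ∞ Φ z) (hinv : (fderiv ℝ Φ z₀).IsInvertible) :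
    ∃ φ : PartialDiffeomorph (𝓡 3) (𝓡 3) E3 E3 ∞, z₀ ∈ φ.source ∧ φ.source ⊆ U ∧
      ∀ z, φ z = Φ z := by
  obtain ⟨e, he⟩ := hinv
  have hd : HasFDerivAt Φ (e : E3 →L[ℝ] E3) z₀ := by
    rw [he]
    exact (diffAt (hΦ z₀ hz₀)).hasFDerivAt
  set O := (hΦ z₀ hz₀).toOpenPartialHomeomorph Φ hd (by simp) with hO
  have hOΦ : (O : E3 → E3) = Φ := (hΦ z₀ hz₀).toOpenPartialHomeomorph_coe hd (by simp)
  -- Invertible maps form an open set, so after shrinking the local inverse is smooth on the whole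
  -- target and not just at the image of `z₀`.
  have hV : ∀ᶠ z in 𝓝 z₀, (fderiv ℝ Φ z).IsInvertible ∧ z ∈ U := by
    have h1 : ContinuousAt (fderiv ℝ Φ) z₀ :=
      ((hΦ z₀ hz₀).fderiv_right (m := ∞) (by simp)).continuousAt
    have h2 := h1.eventually (he ▸ e.nhds)
    filter_upwards [h2, hU.mem_nhds hz₀] with z hz hzU
    exact ⟨hz, hzU⟩
  obtain ⟨V, hVsub, hVo, hzV⟩ := eventually_nhds_iff.1 hV
  set O' := O.restrOpen V hVo with hO'
  have hsrc : ∀ z ∈ O'.source, z ∈ V := fun z hz => by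
    rw [OpenPartialHomeomorph.restrOpen_source] at hz
    exact hz.2
  have hO'Φ : ∀ z, O' z = Φ z := fun z => congrFun hOΦ z
  refine ⟨⟨O'.toPartialEquiv, O'.open_source, O'.open_target, ?_, ?_⟩, ?_, ?_, hO'Φ⟩
  · intro z hz
    exact (((hΦ z (hVsub z (hsrc z hz)).2).congr_of_eventuallyEq
      (Filter.Eventually.of_forall hO'Φ)).contMDiffAt).contMDiffWithinAt
  · intro y hy
    have hx := O'.map_target hy
    obtain ⟨e', he'⟩ := (hVsub _ (hsrc _ hx)).1
    have hc := hΦ _ (hVsub _ (hsrc _ hx)).2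
    have hfun : (O' : E3 → E3) = Φ := funext hO'Φ
    have h3 : HasFDerivAt (O' : E3 → E3) (e' : E3 →L[ℝ] E3) (O'.symm y) := by
      rw [hfun, he']
      exact (diffAt hc).hasFDerivAt
    have h4 : ContDiffAt ℝ ∞ (O' : E3 → E3) (O'.symm y) := by
      rw [hfun]
      exact hc
    exact ((O'.contDiffAt_symm hy h3 h4).contMDiffAt).contMDiffWithinAt
  · change z₀ ∈ O'.source
    rw [OpenPartialHomeomorph.restrOpen_source]
    exact ⟨(hΦ z₀ hz₀).mem_toOpenPartialHomeomorph_source hd (by simp), hzV⟩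
  · intro z hz
    exact (hVsub z (hsrc z hz)).2

/-- Trivial systems require `F₁, F₂` smooth on all of `ℝ`, whereas the constructions give functions
near one point; a bump function extends them. -/
theorem exists_contDiff_eventuallyEq {f : ℝ → ℝ} {c r : ℝ} (hr : 0 < r)
    (hf : ∀ t ∈ Metric.ball c r, ContDiffAt ℝ ∞ f t) :
    ∃ g : ℝ → ℝ, ContDiff ℝ ∞ g ∧ g =ᶠ[𝓝 c] f := by
  let χ : ContDiffBump c := ⟨r / 3, r / 2, by positivity, by linarith⟩
  refine ⟨fun t => χ t * f t, ?_, ?_⟩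
  · rw [contDiff_iff_contDiffAt]
    intro t
    by_cases ht : t ∈ Metric.ball c r
    · exact χ.contDiff.contDiffAt.mul (hf t ht)
    · have h1 : t ∉ tsupport χ := by
        rw [χ.tsupport_eq]
        intro h
        exact ht (Metric.closedBall_subset_ball (by change r / 2 < r; linarith) h)
      have h2 : (fun t => χ t * f t) =ᶠ[𝓝 t] fun _ => 0 := by
        filter_upwards [notMem_tsupport_iff_eventuallyEq.1 h1] with s hs
        rw [hs, Pi.zero_apply, zero_mul]
      exact contDiffAt_const.congr_of_eventuallyEq h2
  · filter_upwards [χ.eventuallyEq_one] with t ht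
    rw [ht, Pi.one_apply, one_mul]

/-- Smooth local solutions of the linear equation `p'' = εp + Np'`. -/
theorem exists_linear_ode_solution {N : ℝ → ℝ} (hN : ContDiff ℝ ∞ N) (ε c p₀ q₀ : ℝ) :
    ∃ p : ℝ → ℝ, ContDiff ℝ ∞ p ∧ p c = p₀ ∧ deriv p c = q₀ ∧
      ∀ᶠ t in 𝓝 c, deriv (deriv p) t = ε * p t + N t * deriv p t := by
  -- Time is added as a first component with speed `1`, which makes the equation autonomous; the
  -- state is `(t, p, p')`.
  let V : ℝ × ℝ × ℝ → ℝ × ℝ × ℝ := fun x => (1, x.2.2, ε * x.2.1 + N x.1 * x.2.2)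
  have hV : ContDiff ℝ ∞ V := by fun_prop
  obtain ⟨α, hα0, δ, hδ, hα⟩ :=
    (hV.contDiffAt.of_le (by simp) : ContDiffAt ℝ 1 V (c, p₀, q₀)).exists_forall_mem_closedBall_exists_eq_forall_mem_Ioo_hasDerivAt₀ c
  have hball : Metric.ball c (δ / 2) = Set.Ioo (c - δ / 2) (c + δ / 2) := Real.ball_eq_Ioo c _
  have hα' : ∀ t ∈ Metric.ball c (δ / 2), HasDerivAt α (V (α t)) t := by
    intro t ht
    rw [hball] at ht
    exact hα t ⟨by linarith [ht.1], by linarith [ht.2]⟩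
  have hsmooth : ContDiffOn ℝ ∞ α (Set.Icc (c - δ / 2) (c + δ / 2)) := by
    refine ODE.contDiffOn_enat_Icc_of_hasDerivWithinAt (n := ⊤) (f := fun _ => V) (u := Set.univ)
      ?_ ?_ (Set.mapsTo_univ _ _)
    · exact (hV.comp contDiff_snd).contDiffOn
    · intro t ht
      exact (hα t ⟨by linarith [ht.1], by linarith [ht.2]⟩).hasDerivWithinAt
  have hsm : ∀ t ∈ Metric.ball c (δ / 2), ContDiffAt ℝ ∞ α t := by
    intro t ht
    rw [hball] at ht
    exact hsmooth.contDiffAt (Icc_mem_nhds ht.1 ht.2)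
  have hfst : ∀ t ∈ Metric.ball c (δ / 2), (α t).1 = t := by
    intro t ht
    have h1 : ∀ s ∈ Metric.ball c (δ / 2), HasDerivAt (fun s => (α s).1 - s) 0 s := by
      intro s hs
      have h2 : HasDerivAt (fun s => (α s).1) 1 s :=
        (ContinuousLinearMap.fst ℝ ℝ (ℝ × ℝ)).hasFDerivAt.comp_hasDerivAt s (hα' s hs)
      simpa using h2.fun_sub (hasDerivAt_id' s)
    have h2 := (convex_ball c (δ / 2)).is_const_of_fderivWithin_eq_zero (𝕜 := ℝ)
      (f := fun s => (α s).1 - s)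
      (fun s hs => (h1 s hs).differentiableAt.differentiableWithinAt)
      (fun s hs => by
        rw [fderivWithin_of_isOpen Metric.isOpen_ball hs]
        ext
        simp [(h1 s hs).deriv])
      ht (Metric.mem_ball_self (by positivity))
    simp only [hα0, sub_self] at h2
    linarith
  obtain ⟨p, hp, hpe⟩ := exists_contDiff_eventuallyEq (f := fun t => (α t).2.1)
    (c := c) (r := δ / 2) (by positivity) fun t ht => (hsm t ht).snd.fst
  have hα2 : ∀ t ∈ Metric.ball c (δ / 2), HasDerivAt (fun t => (α t).2)
      ((α t).2.2, ε * (α t).2.1 + N (α t).1 * (α t).2.2) t := fun t ht =>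
    (ContinuousLinearMap.snd ℝ ℝ (ℝ × ℝ)).hasFDerivAt.comp_hasDerivAt t (hα' t ht)
  have hα3 : ∀ t ∈ Metric.ball c (δ / 2), HasDerivAt (fun t => (α t).2.1) (α t).2.2 t :=
    fun t ht => (ContinuousLinearMap.fst ℝ ℝ ℝ).hasFDerivAt.comp_hasDerivAt t (hα2 t ht)
  have hα4 : ∀ t ∈ Metric.ball c (δ / 2), HasDerivAt (fun t => (α t).2.2)
      (ε * (α t).2.1 + N (α t).1 * (α t).2.2) t := fun t ht =>
    (ContinuousLinearMap.snd ℝ ℝ ℝ).hasFDerivAt.comp_hasDerivAt t (hα2 t ht)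
  have hmem : Metric.ball c (δ / 2) ∈ 𝓝 c := Metric.ball_mem_nhds _ (by positivity)
  have hd1 : deriv p =ᶠ[𝓝 c] fun t => (α t).2.2 := by
    filter_upwards [hpe.eventuallyEq_nhds, hmem] with t ht htb
    rw [ht.deriv_eq]
    exact (hα3 t htb).deriv
  refine ⟨p, hp, by rw [hpe.eq_of_nhds, hα0], by rw [hd1.eq_of_nhds, hα0], ?_⟩
  filter_upwards [hd1.eventuallyEq_nhds, hpe, hmem] with t ht hpt htb
  rw [ht.deriv_eq, ht.eq_of_nhds, hpt, (hα4 t htb).deriv, hfst t htb]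

/-! ### Bracket relations of a canonical pair -/

/-- The Jacobi identity for a canonical pair with `[F,[F,G]] = k₂ [G,F]`. -/
theorem canonical_jacobi {F G : E3 → E3} {ε : ℝ} {U : Set E3} (hU : IsOpen U)
    (hε : ε ≠ 0) (hF : ∀ z ∈ U, ContDiffAt ℝ ∞ F z) (hG : ∀ z ∈ U, ContDiffAt ℝ ∞ G z)
    (hK0 : ∀ z ∈ U, eK F G 0 z = 0) (hK2 : ∀ z ∈ U, eK F G 2 z = 0)
    (hL : ∀ z ∈ U, eL F G 0 z = ε) {z : E3} (hz : z ∈ U) :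
    eK F G 1 z = 0 ∧
      eL F G 1 z = fderiv ℝ (eL F G 2) z (F z) + fderiv ℝ (eK F G 1) z (G z) := by
  set H : E3 → E3 := lieBracket ℝ G F with hH
  have hL0 : ∀ y ∈ U, eL F G 0 y ≠ 0 := fun y hy => by rw [hL y hy]; exact hε
  have a1 : ∀ y ∈ U, A1At F G y := fun y hy => a1At_of_eL_ne_zero (hL0 y hy)
  have a2 : ∀ y ∈ U, A2At F G y := fun y hy => a2At_of_eL_ne_zero (hL0 y hy)
  have sF := hF z hz
  have sG := hG z hz
  have sH : ContDiffAt ℝ ∞ H z := contDiffAt_lieBracket sG sF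
  have s2 := contDiffAt_eL sF sG (a1 z hz) 2
  have s1 := contDiffAt_eL sF sG (a1 z hz) 1
  have sk := contDiffAt_eK sF sG (a2 z hz) 1
  have eFG : lieBracket ℝ F G = fun y => -H y := by
    funext y
    rw [lieBracket_swap]
  have eFH : lieBracket ℝ F H =ᶠ[𝓝 z] fun y => (-eK F G 1 y) • H y := by
    filter_upwards [hU.mem_nhds hz] with y hy
    rw [hH, lieBracket_lieBracket_swap, eK_sum (a2 y hy), hK0 y hy, hK2 y hy]
    module
  have eGH : lieBracket ℝ G H =ᶠ[𝓝 z]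
      fun y => ε • F y + (1 : ℝ) • (eL F G 1 y • G y + eL F G 2 y • H y) := by
    filter_upwards [hU.mem_nhds hz] with y hy
    rw [hH, eL_sum (a1 y hy), hL y hy]
    module
  have J := leibniz_identity_lieBracket (𝕜 := ℝ) (n := ∞) (by simpa using ENat.LEInfty.out) sF sG sH
  have j2 : lieBracket ℝ (lieBracket ℝ F G) H z = 0 := by
    rw [lieBracket_swap, eFG]
    have := lieBracket_const_smul_right (𝕜 := ℝ) (V := H) (c := (-1 : ℝ)) (diffAt sH)
    rw [lieBracket_self, Pi.zero_apply, smul_zero] at this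
    rw [show (fun y => -H y) = (-1 : ℝ) • H by funext y; simp, this, neg_zero]
  have dG := diffAt sG
  have dF := diffAt sF
  have dH := diffAt sH
  have d1 := diffAt s1
  have d2 := diffAt s2
  have j1 : lieBracket ℝ F (lieBracket ℝ G H) z =
      (fderiv ℝ (eL F G 1) z (F z) • G z - eL F G 1 z • H z) +
        (fderiv ℝ (eL F G 2) z (F z) • H z - (eL F G 2 z * eK F G 1 z) • H z) := by
    rw [Filter.EventuallyEq.rfl.lieBracket_vectorField_eq eGH,
      lieBracket_smul_add_smul_right F (differentiableAt_const ε) (differentiableAt_const 1) dF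
        ((d1.fun_smul dG).fun_add (d2.fun_smul dH)),
      lieBracket_smul_add_smul_right F d1 d2 dG dH, eFH.eq_of_nhds, eFG]
    simp only [fderiv_fun_const, Pi.zero_apply, zero_apply, lieBracket_self]
    module
  have j3 : lieBracket ℝ G (lieBracket ℝ F H) z =
      (-fderiv ℝ (eK F G 1) z (G z)) • H z - eK F G 1 z •
        (ε • F z + eL F G 1 z • G z + eL F G 2 z • H z) := by
    rw [Filter.EventuallyEq.rfl.lieBracket_vectorField_eq eFH,
      lieBracket_smul_right (diffAt sk).fun_neg dH, eGH.eq_of_nhds, fderiv_fun_neg]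
    simp only [neg_apply]
    module
  rw [j1, j2, j3] at J
  -- Comparing components of the Jacobi identity in the frame `F, G, H`: the `F` component is `εk₂ =
  -- 0`, and the `H` component gives the formula for `λ₂`.
  obtain ⟨h0, -, h2⟩ := (linearIndependent_three_iff _ _ _).1 (a1 z hz) (eK F G 1 z * ε)
    (fderiv ℝ (eL F G 1) z (F z) + eK F G 1 z * eL F G 1 z)
    (fderiv ℝ (eL F G 2) z (F z) - eL F G 1 z + fderiv ℝ (eK F G 1) z (G z))
    (by
      rw [← sub_eq_zero] at J
      rw [← J]
      module)
  exact ⟨(mul_eq_zero.1 h0).resolve_right hε, by linarith⟩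

/-- `k₂` vanishes on the whole open set, so its derivative drops out of the formula for `λ₂`, and
`L_F ν = 0` removes the rest. -/
theorem canonical_brackets {F G : E3 → E3} {ε : ℝ} {U : Set E3} (hU : IsOpen U)
    (hε : ε ≠ 0) (hF : ∀ z ∈ U, ContDiffAt ℝ ∞ F z) (hG : ∀ z ∈ U, ContDiffAt ℝ ∞ G z)
    (hK0 : ∀ z ∈ U, eK F G 0 z = 0) (hK2 : ∀ z ∈ U, eK F G 2 z = 0)
    (hL : ∀ z ∈ U, eL F G 0 z = ε) (hν : ∀ z ∈ U, fderiv ℝ (eL F G 2) z (F z) = 0)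
    {z : E3} (hz : z ∈ U) :
    lieBracket ℝ F (lieBracket ℝ G F) z = 0 ∧
      lieBracket ℝ G (lieBracket ℝ G F) z = ε • F z + eL F G 2 z • lieBracket ℝ G F z := by
  have hJ := fun y (hy : y ∈ U) => canonical_jacobi hU hε hF hG hK0 hK2 hL hy
  have hL0 : eL F G 0 z ≠ 0 := by rw [hL z hz]; exact hε
  have hk : eK F G 1 =ᶠ[𝓝 z] fun _ => 0 := by
    filter_upwards [hU.mem_nhds hz] with y hy using (hJ y hy).1
  have hl : eL F G 1 z = 0 := by
    rw [(hJ z hz).2, hν z hz, hk.fderiv_eq]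
    simp
  constructor
  · rw [lieBracket_lieBracket_swap, eK_sum (a2At_of_eL_ne_zero hL0), hK0 z hz, hK2 z hz,
      (hJ z hz).1]
    simp
  · rw [eL_sum (a1At_of_eL_ne_zero hL0), hL z hz, hl]
    simp

/-! ### Trivialising coordinates -/

theorem linearIndependent_standard : LinearIndependent ℝ
    ![(!₂[1, 0, 0] : E3), (!₂[0, 1, 0] : E3), (!₂[0, 0, 1] : E3)] := by
  rw [linearIndependent_three_iff]
  intro a b c h
  have h0 := congrArg (fun v : E3 => v 0) h
  have h1 := congrArg (fun v : E3 => v 1) h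
  have h2 := congrArg (fun v : E3 => v 2) h
  simp at h0 h1 h2
  exact ⟨h0, h1, h2⟩

theorem hasFDerivAt_vec3 {P Q R : E3 → ℝ} {z : E3} (hP : DifferentiableAt ℝ P z)
    (hQ : DifferentiableAt ℝ Q z) (hR : DifferentiableAt ℝ R z) (v : E3) :
    DifferentiableAt ℝ (fun y => (!₂[P y, Q y, R y] : E3)) z ∧
      fderiv ℝ (fun y => (!₂[P y, Q y, R y] : E3)) z v =
        !₂[fderiv ℝ P z v, fderiv ℝ Q z v, fderiv ℝ R z v] := by
  have hd : DifferentiableAt ℝ (fun y => (!₂[P y, Q y, R y] : E3)) z := by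
    rw [differentiableAt_euclidean]
    intro i
    fin_cases i <;> assumption
  refine ⟨hd, ?_⟩
  ext i
  have h1 : fderiv ℝ (fun y => (!₂[P y, Q y, R y] : E3) i) z v =
      fderiv ℝ (fun y => (!₂[P y, Q y, R y] : E3)) z v i :=
    congrArg (fun L => L v)
      ((EuclideanSpace.proj i : E3 →L[ℝ] ℝ).hasFDerivAt.comp z hd.hasFDerivAt).fderiv
  rw [← h1]
  fin_cases i <;> rfl

theorem contDiffAt_vec3 {P Q R : E3 → ℝ} {z : E3} (hP : ContDiffAt ℝ ∞ P z)
    (hQ : ContDiffAt ℝ ∞ Q z) (hR : ContDiffAt ℝ ∞ R z) :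
    ContDiffAt ℝ ∞ (fun y => (!₂[P y, Q y, R y] : E3)) z := by
  rw [contDiffAt_euclidean]
  intro i
  fin_cases i <;> assumption

/-- A smooth function on a ball whose differential kills `e` for `e 1 = 0` only depends on the
middle coordinate. -/
theorem eq_of_fderiv_eq_zero {n : E3 → ℝ} {y₀ : E3} {ρ : ℝ}
    (hn : ∀ y ∈ Metric.ball y₀ ρ, DifferentiableAt ℝ n y)
    (h0 : ∀ y ∈ Metric.ball y₀ ρ, ∀ e : E3, e 1 = 0 → fderiv ℝ n y e = 0)
    {y : E3} (hy : y ∈ Metric.ball y₀ ρ) :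
    n y = n (y₀ + EuclideanSpace.single 1 (y 1 - y₀ 1)) := by
  set w := y₀ + EuclideanSpace.single 1 (y 1 - y₀ 1) with hw
  -- Projection to the middle axis through the centre stays in the ball, since a coordinate is
  -- bounded by the norm.
  have hwb : w ∈ Metric.ball y₀ ρ := by
    rw [mem_ball_iff_norm] at hy ⊢
    rw [hw, add_sub_cancel_left, PiLp.norm_single]
    exact (PiLp.norm_apply_le (y - y₀) 1).trans_lt hy
  have he : (y - w) 1 = 0 := by simp [hw]
  have hseg : ∀ t ∈ Set.Icc (0 : ℝ) 1, w + t • (y - w) ∈ Metric.ball y₀ ρ := fun t ht =>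
    (convex_ball y₀ ρ).add_smul_sub_mem hwb hy ht
  have hder : ∀ t ∈ Set.Icc (0 : ℝ) 1, HasDerivAt (fun t : ℝ => n (w + t • (y - w))) 0 t := by
    intro t ht
    have h1 : HasDerivAt (fun t : ℝ => w + t • (y - w)) (y - w) t := by
      simpa using ((hasDerivAt_id' t).smul_const (y - w)).const_add w
    have h2 := (hn _ (hseg t ht)).hasFDerivAt.comp_hasDerivAt t h1
    rw [h0 _ (hseg t ht) _ he] at h2
    exact h2
  have := constant_of_has_deriv_right_zero
    (fun t ht => (hder t ht).continuousAt.continuousWithinAt)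
    (fun t ht => (hder t (Set.Ico_subset_Icc_self ht)).hasDerivWithinAt) 1
    (Set.right_mem_Icc.2 zero_le_one)
  simpa using this

/-- If `dν` is a multiple of `ds`, then locally `ν` is a smooth function of `s`. -/
theorem exists_factor {F G H : E3 → E3} {ν s : E3 → ℝ} {z₀ : E3} {U : Set E3} (hU : IsOpen U)
    (hz₀ : z₀ ∈ U) (hli : ∀ z ∈ U, LinearIndependent ℝ ![F z, G z, H z])
    (hν : ∀ z ∈ U, ContDiffAt ℝ ∞ ν z) (hs : ∀ z ∈ U, ContDiffAt ℝ ∞ s z)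
    (hsF : ∀ z ∈ U, fderiv ℝ s z (F z) = 0) (hsG : ∀ z ∈ U, fderiv ℝ s z (G z) = 1)
    (hsH : ∀ z ∈ U, fderiv ℝ s z (H z) = 0) (hνF : ∀ z ∈ U, fderiv ℝ ν z (F z) = 0)
    (hνH : ∀ z ∈ U, fderiv ℝ ν z (H z) = 0) :
    ∃ N : ℝ → ℝ, ContDiff ℝ ∞ N ∧ ∀ᶠ z in 𝓝 z₀, ν z = N (s z) := by
  -- Two constant linear forms, dual to `F` and `H` at `z₀`, complete `s` to coordinates: the
  -- differential at `z₀` sends `F, G, H` to the standard basis.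
  set l₀ := dualForm F G H (fun _ => 1) (fun _ => 0) (fun _ => 0) z₀ with hl₀
  set l₂ := dualForm F G H (fun _ => 0) (fun _ => 0) (fun _ => 1) z₀ with hl₂
  set Ψ : E3 → E3 := fun y => !₂[l₀ y, s y, l₂ y] with hΨ
  have hfd := hasFDerivAt_vec3 (l₀.differentiableAt) (diffAt (hs z₀ hz₀)) (l₂.differentiableAt (x := z₀))
  obtain ⟨φ, hφ0, hφU, hφ⟩ := exists_partialDiffeomorph (Φ := Ψ) hU hz₀
    (fun z hz => contDiffAt_vec3 l₀.contDiff.contDiffAt (hs z hz) l₂.contDiff.contDiffAt) (by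
      refine isInvertible_of_frame (hli z₀ hz₀) ?_
      rw [(hfd _).2, (hfd _).2, (hfd _).2]
      simp only [ContinuousLinearMap.fderiv, hsF z₀ hz₀, hsG z₀ hz₀, hsH z₀ hz₀, hl₀, hl₂,
        dualForm_fst (hli z₀ hz₀), dualForm_snd (hli z₀ hz₀), dualForm_thd (hli z₀ hz₀)]
      exact linearIndependent_standard)
  have hy₀ := apply_mem φ hφ0
  obtain ⟨ρ, hρ, hball⟩ := Metric.isOpen_iff.1 φ.open_target _ hy₀
  have hχ : ∀ y ∈ φ.target, ContDiffAt ℝ ∞ φ.symm y := fun y hy =>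
    (symm_contMDiffAt φ hy).contDiffAt
  have hχU : ∀ y ∈ φ.target, φ.symm y ∈ U := fun y hy => hφU (symm_mem φ hy)
  set n : E3 → ℝ := fun y => ν (φ.symm y) with hn
  have hns : ∀ y ∈ φ.target, ContDiffAt ℝ ∞ n y := fun y hy =>
    (hν _ (hχU y hy)).comp y (hχ y hy)
  have hs1 : ∀ y ∈ φ.target, s (φ.symm y) = y 1 := by
    intro y hy
    have h1 := apply_symm_self φ hy
    rw [hφ] at h1
    exact congrArg (fun v : E3 => v 1) h1
  have hn0 : ∀ y ∈ Metric.ball (φ z₀) ρ, ∀ e : E3, e 1 = 0 → fderiv ℝ n y e = 0 := by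
    intro y hy' e he
    have hy := hball hy'
    have c1 : fderiv ℝ (fun y => s (φ.symm y)) y = _ :=
      fderiv_comp y (diffAt (hs _ (hχU y hy))) (diffAt (hχ y hy))
    have c2 : fderiv ℝ n y = _ := fderiv_comp y (diffAt (hν _ (hχU y hy))) (diffAt (hχ y hy))
    have c3 : (fun y => s (φ.symm y)) =ᶠ[𝓝 y] (EuclideanSpace.proj 1 : E3 →L[ℝ] ℝ) := by
      filter_upwards [φ.open_target.mem_nhds hy] with x hx using hs1 x hx
    rw [c3.fderiv_eq, ContinuousLinearMap.fderiv] at c1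
    have c4 : fderiv ℝ s (φ.symm y) (fderiv ℝ φ.symm y e) = 0 := by
      have := congrArg (fun L => L e) c1
      exact this.symm.trans he
    -- By `c4` the image of `e` is killed by `ds`, so it has no `G` component, and `dν` vanishes on
    -- the other two fields.
    rw [c2, ContinuousLinearMap.comp_apply]
    have hu := frameCoord_three_sum (hli _ (hχU y hy)) finrank_E3 (fderiv ℝ φ.symm y e)
    rw [hu] at c4 ⊢
    simp only [map_add, map_smul, hsF _ (hχU y hy), hsG _ (hχU y hy), hsH _ (hχU y hy),
      hνF _ (hχU y hy), hνH _ (hχU y hy), add_zero, zero_add, smul_eq_mul,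
      mul_one, mul_zero] at c4 ⊢
    rw [c4, zero_mul]
  have key := fun y (hy : y ∈ Metric.ball (φ z₀) ρ) =>
    eq_of_fderiv_eq_zero (fun y hy => diffAt (hns y (hball hy))) hn0 hy
  have hφ1 : ∀ z, φ z 1 = s z := fun z => by rw [hφ]; rfl
  obtain ⟨N, hN, hNe⟩ := exists_contDiff_eventuallyEq (c := s z₀)
    (f := fun t => n (φ z₀ + EuclideanSpace.single 1 (t - φ z₀ 1))) hρ (by
      intro t ht
      have hmem : φ z₀ + EuclideanSpace.single 1 (t - φ z₀ 1) ∈ Metric.ball (φ z₀) ρ := by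
        rw [mem_ball_iff_norm, add_sub_cancel_left, PiLp.norm_single, hφ1]
        exact ht
      refine ContDiffAt.comp (g := n) t (hns _ (hball hmem)) ?_
      have : ContDiff ℝ ∞ (fun t : ℝ => (φ z₀ + EuclideanSpace.single 1 (t - φ z₀ 1) : E3)) := by
        rw [contDiff_euclidean]
        intro i
        fin_cases i <;> simp <;> fun_prop
      exact this.contDiffAt)
  refine ⟨N, hN, ?_⟩
  have hφc : ContinuousAt φ z₀ :=
    (φ.contMDiffOn.contMDiffAt (φ.open_source.mem_nhds hφ0)).continuousAt
  filter_upwards [(hs z₀ hz₀).continuousAt.eventually hNe, φ.open_source.mem_nhds hφ0,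
    hφc.eventually (Metric.ball_mem_nhds _ hρ)] with z h1 h2 h3
  have h4 := key _ h3
  rw [h1, ← hφ1, ← h4, hn]
  simp only [symm_apply_self φ h2]

theorem fderiv_comp_real {p : ℝ → ℝ} {s : E3 → ℝ} {z : E3} (hp : DifferentiableAt ℝ p (s z))
    (hs : DifferentiableAt ℝ s z) (v : E3) :
    fderiv ℝ (fun y => p (s y)) z v = deriv p (s z) * fderiv ℝ s z v := by
  have h := (hp.hasDerivAt.comp_hasFDerivAt z hs.hasFDerivAt).fderiv
  rw [show (fun y => p (s y)) = p ∘ s from rfl, h]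
  simp

/-- A canonical pair with `κ = 0` and `dν` proportional to the form dual to `G` is, in suitable
local coordinates, a trivial system. -/
theorem exists_trivialising_coordinates {F G : E3 → E3} {U : Set E3} (hU : IsOpen U) {z₀ : E3}
    (hz₀ : z₀ ∈ U) (hF : ∀ z ∈ U, ContDiffAt ℝ ∞ F z) (hG : ∀ z ∈ U, ContDiffAt ℝ ∞ G z)
    (hK0 : ∀ z ∈ U, eK F G 0 z = 0) (hK2 : ∀ z ∈ U, eK F G 2 z = 0)
    (hL : ∀ z ∈ U, eL F G 0 z = 1 ∨ eL F G 0 z = -1)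
    (hνF : ∀ z ∈ U, fderiv ℝ (eL F G 2) z (F z) = 0)
    (hνH : ∀ z ∈ U, fderiv ℝ (eL F G 2) z (lieBracket ℝ F G z) = 0) :
    ∃ (φ : PartialDiffeomorph (𝓡 3) (𝓡 3) E3 E3 ∞) (F₁ F₂ : ℝ → ℝ),
      ContDiff ℝ ∞ F₁ ∧ ContDiff ℝ ∞ F₂ ∧ z₀ ∈ φ.source ∧
      ∀ z ∈ φ.source, fderiv ℝ φ z (F z) = eDrift F₁ F₂ (φ z) ∧
        fderiv ℝ φ z (G z) = eControl (φ z) := by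
  have hL0 : ∀ z ∈ U, eL F G 0 z ≠ 0 := by
    intro z hz h
    rcases hL z hz with h' | h' <;> rw [h] at h' <;> norm_num at h'
  have hA1 : ∀ z ∈ U, A1At F G z := fun z hz => a1At_of_eL_ne_zero (hL0 z hz)
  have hsL : ∀ z ∈ U, ∀ i, ContDiffAt ℝ ∞ (eL F G i) z := fun z hz i =>
    contDiffAt_eL (hF z hz) (hG z hz) (hA1 z hz) i
  set ε := eL F G 0 z₀ with hε
  set ν := eL F G 2 with hν
  set H := lieBracket ℝ G F with hH
  -- A continuous function with values `±1` is locally constant, so the sign `ε` may be fixed.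
  have hconst : ∀ᶠ z in 𝓝 z₀, eL F G 0 z = ε := by
    filter_upwards [(hsL z₀ hz₀ 0).continuousAt.eventually (Metric.ball_mem_nhds _ one_pos),
      hU.mem_nhds hz₀] with z hz hzU
    rw [Real.dist_eq, abs_lt, ← hε] at hz
    rcases hL z hzU with h | h <;> rcases hL z₀ hz₀ with h' | h' <;>
      rw [← hε] at h' <;> rw [h, h'] at hz ⊢ <;> norm_num at hz
  obtain ⟨ρ, hρ, hB⟩ := Metric.eventually_nhds_iff_ball.1 (hconst.and (hU.mem_nhds hz₀))
  have hBU : ∀ z ∈ Metric.ball z₀ ρ, z ∈ U := fun z hz => (hB z hz).2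
  have hbr := fun z (hz : z ∈ Metric.ball z₀ ρ) => canonical_brackets Metric.isOpen_ball
    (hL0 z₀ hz₀) (fun z hz => hF z (hBU z hz)) (fun z hz => hG z (hBU z hz))
    (fun z hz => hK0 z (hBU z hz)) (fun z hz => hK2 z (hBU z hz)) (fun z hz => (hB z hz).1)
    (fun z hz => hνF z (hBU z hz)) hz
  have hsH : ∀ z ∈ U, ContDiffAt ℝ ∞ H z := fun z hz => contDiffAt_lieBracket (hG z hz) (hF z hz)
  have hFG : ∀ z, lieBracket ℝ F G z = -H z := fun z => lieBracket_swap
  have hνH' : ∀ z ∈ U, fderiv ℝ ν z (H z) = 0 := fun z hz => by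
    have := hνH z hz
    rwa [hFG, map_neg, neg_eq_zero] at this
  have hprim : ∀ {ρ' : ℝ} (_ : ρ' ≤ ρ) {p q : E3 → ℝ} (r : ℝ)
      (_ : ∀ z ∈ Metric.ball z₀ ρ', ContDiffAt ℝ ∞ p z)
      (_ : ∀ z ∈ Metric.ball z₀ ρ', ContDiffAt ℝ ∞ q z)
      (_ : ∀ z ∈ Metric.ball z₀ ρ', fderiv ℝ p z (G z) = q z)
      (_ : ∀ z ∈ Metric.ball z₀ ρ', fderiv ℝ q z (F z) = fderiv ℝ p z (H z))
      (_ : ∀ z ∈ Metric.ball z₀ ρ', fderiv ℝ q z (G z) = ε * p z + ν z * q z),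
      ∃ P : E3 → ℝ, ∀ z ∈ Metric.ball z₀ ρ', ContDiffAt ℝ ∞ P z ∧ fderiv ℝ P z (F z) = p z ∧
        fderiv ℝ P z (G z) = r ∧ fderiv ℝ P z (H z) = q z := by
    intro ρ' hρ' p q r h1 h2 h3 h4 h5
    have hsub : ∀ z ∈ Metric.ball z₀ ρ', z ∈ Metric.ball z₀ ρ := fun z hz =>
      Metric.ball_subset_ball hρ' hz
    have hsub' : ∀ z ∈ Metric.ball z₀ ρ', z ∈ U := fun z hz => hBU z (hsub z hz)
    exact exists_primitive (ε := ε) (fun z hz => hF z (hsub' z hz))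
      (fun z hz => hG z (hsub' z hz))
      (fun z hz => hsH z (hsub' z hz)) (fun z hz => hA1 z (hsub' z hz)) (fun z _ => hFG z)
      (fun z hz => (hbr z (hsub z hz)).1) (fun z hz => (hbr z (hsub z hz)).2) h1 h2 h3 h4 h5
  -- The form dual to `G` is closed because neither `[F,H]` nor `[G,H]` nor `[F,G]` has a `G`
  -- component; `s` is its primitive.
  obtain ⟨s, hs⟩ := hprim le_rfl (p := fun _ => 0) (q := fun _ => 0) 1
    (fun _ _ => contDiffAt_const) (fun _ _ => contDiffAt_const) (by simp) (by simp) (by simp)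
  obtain ⟨N, hN, hNν⟩ := exists_factor (F := F) (G := G) (H := H) (ν := ν) (s := s)
    Metric.isOpen_ball
    (Metric.mem_ball_self hρ)
    (fun z hz => hA1 z (hBU z hz)) (fun z hz => hsL z (hBU z hz) 2) (fun z hz => (hs z hz).1)
    (fun z hz => (hs z hz).2.1) (fun z hz => (hs z hz).2.2.1) (fun z hz => (hs z hz).2.2.2)
    (fun z hz => hνF z (hBU z hz)) (fun z hz => hνH' z (hBU z hz))
  -- The initial data `(1, 0)` and `(0, 1)` make `dP, dQ` dual to `F, H` at `z₀`, whence `(P, Q, s)`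
  -- is a local diffeomorphism.
  obtain ⟨p₁, hp₁, hp₁0, hp₁1, hp₁e⟩ := exists_linear_ode_solution hN ε (s z₀) 1 0
  obtain ⟨p₂, hp₂, hp₂0, hp₂1, hp₂e⟩ := exists_linear_ode_solution hN ε (s z₀) 0 1
  have hsc : ContinuousAt s z₀ := (hs z₀ (Metric.mem_ball_self hρ)).1.continuousAt
  obtain ⟨ρ', hρ', hB'⟩ := Metric.eventually_nhds_iff_ball.1
    (hNν.and ((hsc.eventually hp₁e).and (hsc.eventually hp₂e)))
  set ρ₁ := min ρ ρ' with hρ₁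
  have hρ₁pos : 0 < ρ₁ := lt_min hρ hρ'
  have hsub1 : ∀ z ∈ Metric.ball z₀ ρ₁, z ∈ Metric.ball z₀ ρ := fun z hz =>
    Metric.ball_subset_ball (min_le_left _ _) hz
  have hsub2 : ∀ z ∈ Metric.ball z₀ ρ₁, z ∈ Metric.ball z₀ ρ' := fun z hz =>
    Metric.ball_subset_ball (min_le_right _ _) hz
  have hcoord : ∀ {p : ℝ → ℝ} (_ : ContDiff ℝ ∞ p)
      (_ : ∀ z ∈ Metric.ball z₀ ρ₁, deriv (deriv p) (s z) = ε * p (s z) + ν z * deriv p (s z)),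
      ∃ P : E3 → ℝ, ∀ z ∈ Metric.ball z₀ ρ₁, ContDiffAt ℝ ∞ P z ∧
        fderiv ℝ P z (F z) = p (s z) ∧ fderiv ℝ P z (G z) = 0 ∧
        fderiv ℝ P z (H z) = deriv p (s z) := by
    intro p hp hode
    have hp' : ContDiff ℝ ∞ (deriv p) := (contDiff_infty_iff_deriv.1 hp).2
    have d1 : ∀ t, DifferentiableAt ℝ p t := fun t => hp.contDiffAt.differentiableAt (by simp)
    have d2 : ∀ t, DifferentiableAt ℝ (deriv p) t := fun t =>
      hp'.contDiffAt.differentiableAt (by simp)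
    have ds : ∀ z ∈ Metric.ball z₀ ρ₁, DifferentiableAt ℝ s z := fun z hz =>
      diffAt (hs z (hsub1 z hz)).1
    refine hprim (min_le_left _ _) 0
      (fun z hz => hp.contDiffAt.comp z (hs z (hsub1 z hz)).1)
      (fun z hz => hp'.contDiffAt.comp z (hs z (hsub1 z hz)).1) ?_ ?_ ?_
    · intro z hz
      rw [fderiv_comp_real (d1 _) (ds z hz), (hs z (hsub1 z hz)).2.2.1, mul_one]
    · intro z hz
      rw [fderiv_comp_real (d1 _) (ds z hz), fderiv_comp_real (d2 _) (ds z hz),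
        (hs z (hsub1 z hz)).2.1, (hs z (hsub1 z hz)).2.2.2, mul_zero, mul_zero]
    · intro z hz
      rw [fderiv_comp_real (d2 _) (ds z hz), (hs z (hsub1 z hz)).2.2.1, mul_one, hode z hz]
  obtain ⟨P, hP⟩ := hcoord hp₁ fun z hz => by
    rw [(hB' z (hsub2 z hz)).2.1, (hB' z (hsub2 z hz)).1]
  obtain ⟨Q, hQ⟩ := hcoord hp₂ fun z hz => by
    rw [(hB' z (hsub2 z hz)).2.2, (hB' z (hsub2 z hz)).1]
  set Φ : E3 → E3 := fun y => !₂[P y, Q y, s y] with hΦ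
  have hfd := fun z (hz : z ∈ Metric.ball z₀ ρ₁) => hasFDerivAt_vec3 (diffAt (hP z hz).1)
    (diffAt (hQ z hz).1) (diffAt (hs z (hsub1 z hz)).1)
  have hz₁ : z₀ ∈ Metric.ball z₀ ρ₁ := Metric.mem_ball_self hρ₁pos
  obtain ⟨φ, hφ0, hφU, hφ⟩ := exists_partialDiffeomorph (Φ := Φ) Metric.isOpen_ball hz₁
    (fun z hz => contDiffAt_vec3 (hP z hz).1 (hQ z hz).1 (hs z (hsub1 z hz)).1) (by
      refine isInvertible_of_frame (hA1 z₀ hz₀) ?_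
      rw [(hfd z₀ hz₁ _).2, (hfd z₀ hz₁ _).2, (hfd z₀ hz₁ _).2, ← hH, (hP z₀ hz₁).2.1,
        (hP z₀ hz₁).2.2.1, (hP z₀ hz₁).2.2.2, (hQ z₀ hz₁).2.1, (hQ z₀ hz₁).2.2.1,
        (hQ z₀ hz₁).2.2.2, (hs z₀ (hsub1 z₀ hz₁)).2.1, (hs z₀ (hsub1 z₀ hz₁)).2.2.1,
        (hs z₀ (hsub1 z₀ hz₁)).2.2.2, hp₁0, hp₁1, hp₂0, hp₂1]
      rw [linearIndependent_three_iff]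
      intro a b c h
      have h0 := congrArg (fun v : E3 => v 0) h
      have h1 := congrArg (fun v : E3 => v 1) h
      have h2 := congrArg (fun v : E3 => v 2) h
      simp at h0 h1 h2
      -- The frame `F, G, H` goes to the first, third and second basis vectors, hence the permuted
      -- order.
      exact ⟨h0, h2, h1⟩)
  have hφΦ : (φ : E3 → E3) = Φ := funext hφ
  refine ⟨φ, p₁, p₂, hp₁, hp₂, hφ0, fun z hzs => ?_⟩
  have hz := hφU hzs
  rw [hφΦ, (hfd z hz _).2, (hfd z hz _).2, (hP z hz).2.1, (hQ z hz).2.1,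
    (hs z (hsub1 z hz)).2.1, (hP z hz).2.2.1, (hQ z hz).2.2.1, (hs z (hsub1 z hz)).2.2.1]
  exact ⟨rfl, rfl⟩

/-! ### Sufficiency of the conditions -/

section Manifold

variable {M : Type*} [TopologicalSpace M] [ChartedSpace E3 M] [IsManifold (𝓡 3) ∞ M]
  {f g fc gc : ∀ x : M, TangentSpace (𝓡 3) x}

theorem locallyTrivialisable_of_trivialityConditions (hc : IsCanonicalPairOf f g fc gc) {x₀ : M}
    (h : ∀ᶠ x in 𝓝 x₀, TrivialityConditionsAt fc gc x) : LocallyTrivialisableAt f g x₀ := by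
  obtain ⟨hfc, hgc, ⟨a, b, ha, hb, hab⟩, hK, hL⟩ := hc
  have hx₀ := mem_chartDiffeo_source x₀
  set χ := chartDiffeo x₀
  have hz₀ := apply_mem χ hx₀
  have hcont : ContinuousAt χ.symm (χ x₀) := (symm_contMDiffAt χ hz₀).continuousAt
  have h' : ∀ᶠ z in 𝓝 (χ x₀), TrivialityConditionsAt fc gc (χ.symm z) ∧ z ∈ χ.target := by
    refine Filter.Eventually.and (hcont.eventually ?_) (χ.open_target.mem_nhds hz₀)
    rw [symm_apply_self χ hx₀]
    exact h
  obtain ⟨U, hUsub, hU, hzU⟩ := eventually_nhds_iff.1 h'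
  have hL0 : ∀ z ∈ U, eL (push χ fc) (push χ gc) 0 z ≠ 0 := by
    intro z hz
    rw [eL_push χ hfc hgc 0 (hUsub z hz).2]
    rcases hL (χ.symm z) with h | h <;> rw [h] <;> norm_num
  have hlie : ∀ z ∈ U, ∀ v : ∀ x : M, TangentSpace (𝓡 3) x,
      lieDeriv v (centroAffineCurvature fc gc) (χ.symm z) =
        fderiv ℝ (eL (push χ fc) (push χ gc) 2) z (push χ v z) := fun z hz v =>
    lieDeriv_push χ v (hUsub z hz).2
      (diffAt (contDiffAt_eL (push_contDiffAt χ hfc (hUsub z hz).2)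
        (push_contDiffAt χ hgc (hUsub z hz).2) (a1At_of_eL_ne_zero (hL0 z hz)) 2))
      fun y hy => (eL_push χ hfc hgc 2 hy).symm
  obtain ⟨ψ, F₁, F₂, hF₁, hF₂, hψ0, hψ⟩ := exists_trivialising_coordinates hU hzU
    (fun z hz => push_contDiffAt χ hfc (hUsub z hz).2)
    (fun z hz => push_contDiffAt χ hgc (hUsub z hz).2)
    (fun z hz => by
      rw [eK_push χ hfc hgc 0 (hUsub z hz).2]
      exact (hUsub z hz).1.1)
    (fun z hz => by rw [eK_push χ hfc hgc 2 (hUsub z hz).2, hK])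
    (fun z hz => by
      rw [eL_push χ hfc hgc 0 (hUsub z hz).2]
      exact hL _)
    (fun z hz => by rw [← hlie z hz fc, (hUsub z hz).1.2.1])
    (fun z hz => by
      rw [← push_bracket χ hfc hgc (hUsub z hz).2, ← hlie z hz (bracket fc gc),
        (hUsub z hz).1.2.2])
  -- The feedback is the one defining the canonical pair, since that pair itself becomes the trivial
  -- system in the new coordinates.
  refine ⟨F₁, F₂, χ.trans ψ x₀, hF₁, hF₂, χ.trans ψ, a, b, ?_, rfl, ha.contMDiffOn,
    hb.contMDiffOn, ?_⟩
  · change x₀ ∈ χ.source ∩ χ ⁻¹' ψ.source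
    exact ⟨hx₀, hψ0⟩
  · intro x hx
    obtain ⟨hx1, hx2⟩ : x ∈ χ.source ∩ χ ⁻¹' ψ.source := hx
    obtain ⟨hb0, e1, e2⟩ := hab x
    rw [← e1, ← e2]
    have hd : ∀ v : ∀ x : M, TangentSpace (𝓡 3) x,
        mfderiv (𝓡 3) (𝓡 3) (χ.trans ψ) x (v x) = fderiv ℝ ψ (χ x) (push χ v (χ x)) := by
      intro v
      rw [push_apply χ v hx1, ← mfderiv_eq_fderiv]
      exact congrArg (fun L => L (v x)) (mfderiv_comp x (ψ.mdifferentiableAt (by simp) hx2)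
        (χ.mdifferentiableAt (by simp) hx1))
    rw [hd, hd, (hψ _ hx2).1, (hψ _ hx2).2]
    exact ⟨hb0, rfl, rfl⟩

end Manifold

end TrivialControl

end

theorem mainTheorem1 {M : Type*} [TopologicalSpace M] [ChartedSpace TrivialControl.E3 M]
    [IsManifold (𝓡 3) ∞ M]
    (f g : ∀ x : M, TangentSpace (𝓡 3) x)
    (hf : TrivialControl.IsSmoothVectorField f) (hg : TrivialControl.IsSmoothVectorField g)
    (hA1 : TrivialControl.AssumptionA1 f g) (hA2 : TrivialControl.AssumptionA2 f g) :
    TrivialControl.IsCanonicalPairOf f g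
      (TrivialControl.canonicalDrift f g) (TrivialControl.canonicalControl f g) ∧
    ∀ fc gc : ∀ x : M, TangentSpace (𝓡 3) x, TrivialControl.IsCanonicalPairOf f g fc gc →
      (TrivialControl.LocallyTrivialisable f g ↔
        ∀ x : M, TrivialControl.TrivialityConditionsAt fc gc x) ∧
      ∀ x₀ : M, (TrivialControl.LocallyTrivialisableAt f g x₀ ↔
        ∀ᶠ x in 𝓝 x₀, TrivialControl.TrivialityConditionsAt fc gc x) := by
  refine ⟨TrivialControl.isCanonicalPairOf_canonical hf hg hA1 hA2, fun fc gc hc => ?_⟩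
  have key : ∀ x₀ : M, (TrivialControl.LocallyTrivialisableAt f g x₀ ↔
      ∀ᶠ x in 𝓝 x₀, TrivialControl.TrivialityConditionsAt fc gc x) := fun x₀ =>
    ⟨TrivialControl.trivialityConditions_of_locallyTrivialisable hc,
      TrivialControl.locallyTrivialisable_of_trivialityConditions hc⟩
  exact ⟨⟨fun h x => ((key x).1 (h x)).self_of_nhds,
    fun h x => (key x).2 (Filter.Eventually.of_forall h)⟩, key⟩
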